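/- **Theorem (Carlet–Dubrovin–Zhang, part 1).** *NLS hierarchy.* Let $\mathcal A=\mathbb C[q_0,r_0,q_1,r_1,\dots]$ with the derivation $\partial q_i=q_{i+1}$, $\partial r_i=r_{i+1}$, $q=q_0$, $r=r_0$. Let $R^{\rm NLS}(\xi)=\begin{pmatrix}2&0\\0&0\end{pmatrix}+O(\xi^{-1})$ be the unique $2\times2$ matrix over $\mathcal A[\epsilon][[\xi^{-1}]]$ with $\Bigl[\epsilon\partial+\begin{pmatrix}-\xi&-q\\ r&\xi\end{pmatrix},R^{\rm NLS}(\xi)\Bigr]=0$, $\operatorname{tr}R^{\rm NLS}=2$, $\det R^{\rm NLS}=0$. Let $B_j$, $C_j$ be the coefficients of $\xi^{-j-1}$ in its $(1,2)$ and $(2,1)$ entries, and define $\Omega^{\rm NLS}_{i,j}\in\mathcal A[\epsilon]$ by $$\sum_{i,j\ge0}\frac{\Omega^{\rm NLS}_{i,j}}{2^{i+j}\,\xi^{i+2}\nu^{j+2}}=\frac{\operatorname{tr}R^{\rm NLS}(\xi)R^{\rm NLS}(\nu)-4}{(\xi-\nu)^2}.$$ A pair $(q,r)$ of functions of ${\bf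 t}=(t_0,t_1,\dots)$ is a solution of the NLS (AKNS) hierarchy if $\epsilon\,\partial q/\partial t_j=2^{j+1}B_{j+1}$ and $\epsilon\,\partial r/\partial t_j=2^{j+1}C_{j+1}$ for all $j\ge0$, after the substitution $q_i=\partial_{t_0}^iq$, $r_i=\partial_{t_0}^ir$ (that is, $\partial_X=\partial_{t_0}$). A non-vanishing function $\tau({\bf t})$ is a tau-function of this solution if, after the same substitution, $\epsilon^2\,\partial_{t_i}\partial_{t_j}\log\tau=\Omega^{\rm NLS}_{i,j}$ for all $i,j\ge0$. *Toda lattice hierarchy.* In $\mathbb Z[v_k,w_k:k\in\mathbb Z]$ with the shift $\Lambda v_k=v_{k+1}$, $\Lambda w_k=w_{k+1}$, $v=v_0$, $w=w_0$, let $R(\lambda)=\begin{pmatrix}1&0\\0&0\end{pmatrix}+O(\lambda^{-1})$ be the unique $2\times 2$ matrix series in $\lambda^{-1}$ with $\Lambda(R(\lambda))\,U(\lambda)=U(\lambda)R(\lambda)$, where $U(\lambda)=\begin{pmatrix}v-\lambda&w\\-1&0\end{pmatrix}$, and $\operatorname{tr}R=1$, $\det R=0$. Let $a_j$, $c_j$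 be the coefficients of $\lambda^{-j-1}$ in its $(1,1)$ and $(2,1)$ entries and define $\Omega_{i,j}$ by $$\sum_{i,j\ge 0}\frac{\Omega_{i,j}}{\lambda^{i+2}\mu^{j+2}}=\frac{\operatorname{tr}R(\lambda)R(\mu)-1}{(\lambda-\mu)^2}.$$ A pair $(v(x;{\bf t}),w(x;{\bf t}))$ is a solution of the Toda lattice hierarchy if $\epsilon\,\partial v/\partial t_j=(\Lambda-1)a_{j+1}$ and $\epsilon\,\partial w/\partial t_j=w\,(\Lambda-1)c_{j+1}$ for all $j\ge0$, after the substitution $v_k=v(x+k\epsilon;{\bf t})$, $w_k=w(x+k\epsilon;{\bf t})$. A non-vanishing function $\tau(x;{\bf t})$ is a tau-function of this solution if, after the same substitution, for all $i,j\ge0$, $$\epsilon^2\partial_{t_i}\partial_{t_j}\log\tau=\Omega_{i,j},\qquad \epsilon\,\partial_{t_i}\log\frac{\tau(x+\epsilon;{\bf t})}{\tau(x;{\bf t})}=\Lambda(c_{i+1}),\qquad \frac{\tau(x+\epsilon;{\bf t})\,\tau(x-\epsilon;{\bf t})}{\tau(x;{\bf t})^2}=w(x;{\bf t}).$$ *Statement.*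 Let $(v,w)$ be an arbitrary solution of the Toda lattice hierarchy with $\epsilon\ne0$, and let $\tau$ be a tau-function of it. Put $$q(x;{\bf t})=\frac{\tau(x+\epsilon;{\bf t})}{\tau(x;{\bf t})},\qquad r(x;{\bf t})=\frac{\tau(x-\epsilon;{\bf t})}{\tau(x;{\bf t})}.$$ Then for every $x$ the pair $(q(x;\cdot),r(x;\cdot))$ is a solution of the NLS hierarchy (with $\partial_X=\partial_{t_0}$), and $\tau(x;\cdot)$ is a tau-function of this solution. The statement holds (1) for complex-valued functions of $x\in\mathbb C$ and of real or complex times ${\bf t}$, smooth in any finitely many times, on any domain that is invariant under $x\mapsto x+\epsilon$ and whose slices at fixed $x$ are open in the directions of any finitely many times; and (2) for formal solutions, i.e. for elements $v,w$ and an invertible element $\tau$ of any commutative $\mathbb C$-algebra with commuting derivations $\partial_{t_j}$, $j\ge0$, an automorphism $\Lambda$ (the shift $x\mapsto x+\epsilon$) commuting with them, and an invertible element $\epsilon$ killed by all $\partial_{t_j}$ and fixed by $\Lambda$. -/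

import Mathlib

noncomputable section

namespace TodaNLS

open PowerSeries

/-! ### Two-point generating series of a `2 × 2` matrix series

A power series in `X` over `P` stands for a series in the inverse of the spectral parameter.
In `P⟦X⟧⟦X⟧` the outer variable is `ξ⁻¹`, the inner one is `ν⁻¹`. -/

/-- The family `Ω i j` satisfies
`∑ Ω i j ξ^(-i-2) ν^(-j-2) = (tr M(ξ) M(ν) - c) / (ξ - ν)^2`.
Since `ξ - ν = (ν⁻¹ - ξ⁻¹) / (ξ⁻¹ ν⁻¹)`, multiplying by `(ξ - ν)^2` gives the identity below. -/
def IsTwoPoint {P : Type*} [CommRing P] (M : Matrix (Fin 2) (Fin 2) P⟦X⟧) (c : P)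
    (Ω : ℕ → ℕ → P) : Prop :=
  ((X : P⟦X⟧⟦X⟧) - C (X : P⟦X⟧)) ^ 2 * PowerSeries.mk (fun i => PowerSeries.mk (fun j => Ω i j)) =
    (M.map (PowerSeries.map (C (R := P))) * M.map (C (R := P⟦X⟧))).trace - C (C c)

/-- The divided difference of a series: `(f(ξ) - f(ν)) = (ξ⁻¹ - ν⁻¹) ∑ f_{i+j+1} ξ^{-i} ν^{-j}`. -/
theorem dividedDiff {P : Type*} [CommRing P] (f : P⟦X⟧) :
    PowerSeries.map (C (R := P)) f - C f =
      ((X : P⟦X⟧⟦X⟧) - C (X : P⟦X⟧)) *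
        PowerSeries.mk (fun i => PowerSeries.mk (fun j => coeff (i + j + 1) f)) := by
  ext i j
  rw [sub_mul]
  rcases i with _ | i <;> rcases j with _ | j <;>
    simp [coeff_succ_X_mul, coeff_zero_X_mul, coeff_C, PowerSeries.coeff_C_mul, add_assoc,
      add_comm, add_left_comm, -coeff_zero_eq_constantCoeff]

theorem existsUnique_isTwoPoint {P : Type*} [CommRing P] [IsDomain P]
    (M : Matrix (Fin 2) (Fin 2) P⟦X⟧) (c : P)
    (htr : M.trace = C c) (hdet : M.det = 0) : ∃! Ω : ℕ → ℕ → P, IsTwoPoint M (c ^ 2) Ω := by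
  have hne : ((X : P⟦X⟧⟦X⟧) - C (X : P⟦X⟧)) ≠ 0 := by
    intro h
    have := congrArg (coeff 1) h
    simp at this
  set e : P⟦X⟧ → P⟦X⟧⟦X⟧ :=
    fun f => PowerSeries.mk (fun i => PowerSeries.mk (fun j => coeff (i + j + 1) f)) with he
  have hd : ∀ f : P⟦X⟧, PowerSeries.map (C (R := P)) f - C f =
      ((X : P⟦X⟧⟦X⟧) - C (X : P⟦X⟧)) * e f := dividedDiff
  refine existsUnique_of_exists_of_unique ⟨fun i j => coeff j (coeff i
    (e (M 0 0) * e (M 1 1) - e (M 0 1) * e (M 1 0))), ?_⟩ ?_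
  · have hmk : PowerSeries.mk (fun i => PowerSeries.mk (fun j => coeff j (coeff i
        (e (M 0 0) * e (M 1 1) - e (M 0 1) * e (M 1 0))))) =
        e (M 0 0) * e (M 1 1) - e (M 0 1) * e (M 1 0) := by
      ext i j
      simp
    show ((X : P⟦X⟧⟦X⟧) - C (X : P⟦X⟧)) ^ 2 * PowerSeries.mk _ = _
    rw [hmk]
    have h1 : M 0 0 + M 1 1 = C c := by rw [← htr, Matrix.trace_fin_two]
    have h2 : M 0 0 * M 1 1 - M 0 1 * M 1 0 = 0 := by rw [← hdet, Matrix.det_fin_two]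
    have a1 := congrArg (PowerSeries.map (C (R := P))) h1
    have a2 := congrArg (PowerSeries.map (C (R := P))) h2
    have b1 := congrArg (C (R := P⟦X⟧)) h1
    have b2 := congrArg (C (R := P⟦X⟧)) h2
    simp only [map_add, map_sub, map_mul, map_zero, PowerSeries.map_C] at a1 a2 b1 b2
    have d00 := hd (M 0 0)
    have d01 := hd (M 0 1)
    have d10 := hd (M 1 0)
    have d11 := hd (M 1 1)
    have key : ((X : P⟦X⟧⟦X⟧) - C (X : P⟦X⟧)) ^ 2 *
        (e (M 0 0) * e (M 1 1) - e (M 0 1) * e (M 1 0)) =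
        (((X : P⟦X⟧⟦X⟧) - C (X : P⟦X⟧)) * e (M 0 0)) * (((X : P⟦X⟧⟦X⟧) - C (X : P⟦X⟧)) * e (M 1 1))
        - (((X : P⟦X⟧⟦X⟧) - C (X : P⟦X⟧)) * e (M 0 1)) *
          (((X : P⟦X⟧⟦X⟧) - C (X : P⟦X⟧)) * e (M 1 0)) := by ring
    rw [key, ← d00, ← d01, ← d10, ← d11]
    simp only [Matrix.trace_fin_two, Matrix.mul_apply, Fin.sum_univ_two, Matrix.map_apply,
      map_pow]
    linear_combination a2 + b2 - (C (M 0 0) + C (M 1 1)) * a1 - (C (C c)) * b1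
  · intro Ω₁ Ω₂ h₁ h₂
    have h := mul_left_cancel₀ (pow_ne_zero 2 hne) (h₁.trans h₂.symm)
    funext i j
    have := congrArg (fun F => coeff j (coeff i F)) h
    simpa using this

/-! ### The NLS (AKNS) hierarchy -/

/-- The jet variables `q_i`, `r_i`, `i ≥ 0`. -/
inductive NLSVar : Type
  | q (i : ℕ)
  | r (i : ℕ)

/-- The ring `𝒜[ε] = ℂ[ε][q₀, r₀, q₁, r₁, …]`; the polynomial variable of `ℂ[X]` is `ε`. -/
abbrev NLSPoly : Type := MvPolynomial NLSVar (Polynomial ℂ)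

/-- The element `ε` of `𝒜[ε]`. -/
def nlsEps : NLSPoly := MvPolynomial.C Polynomial.X

/-- The derivation `∂` with `∂ q_i = q_{i+1}`, `∂ r_i = r_{i+1}`, `∂ ε = 0`. -/
def nlsD : Derivation (Polynomial ℂ) NLSPoly NLSPoly :=
  MvPolynomial.mkDerivation (Polynomial ℂ) fun
    | NLSVar.q i => MvPolynomial.X (NLSVar.q (i + 1))
    | NLSVar.r i => MvPolynomial.X (NLSVar.r (i + 1))

/-- `∂` applied to each coefficient of a series. -/
def nlsDSeries (f : NLSPoly⟦X⟧) : NLSPoly⟦X⟧ := PowerSeries.mk fun n => nlsD (coeff n f)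

/-- `ξ⁻¹ U(ξ)`, where `U(ξ) = !![-ξ, -q; r, ξ]` and `X` stands for `ξ⁻¹`. -/
def nlsU : Matrix (Fin 2) (Fin 2) NLSPoly⟦X⟧ :=
  !![-1, -(X * C (MvPolynomial.X (NLSVar.q 0)));
     X * C (MvPolynomial.X (NLSVar.r 0)), 1]

/-- `R` is a basic matrix resolvent of `ε∂ + U(ξ)`: `R = diag(2,0) + O(ξ⁻¹)`,
`[ε∂ + U(ξ), R] = 0` (written after multiplication by `ξ⁻¹`), `tr R = 2`, `det R = 0`. -/
structure IsNLSResolvent (R : Matrix (Fin 2) (Fin 2) NLSPoly⟦X⟧) : Prop where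
  leading : R.map (constantCoeff (R := NLSPoly)) = !![2, 0; 0, 0]
  comm : (X * C nlsEps : NLSPoly⟦X⟧) • R.map nlsDSeries + (nlsU * R - R * nlsU) = 0
  trace : R.trace = 2
  det : R.det = 0

/-- Recursive computation of the coefficients of the entries of the resolvent. -/
def nlsCoef : ℕ → NLSPoly × NLSPoly × NLSPoly
  | 0 => 0
  | m + 1 =>
    (-MvPolynomial.C (Polynomial.C (1 / 2 : ℂ)) *
        ∑ i : Fin m, ((nlsCoef (i + 1)).1 * (nlsCoef (m - i)).1 +
          (nlsCoef (i + 1)).2.1 * (nlsCoef (m - i)).2.2),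
      MvPolynomial.C (Polynomial.C (1 / 2 : ℂ)) * (nlsEps * nlsD (nlsCoef m).2.1) +
        MvPolynomial.X (NLSVar.q 0) * ((nlsCoef m).1 + if m = 0 then 1 else 0),
      -(MvPolynomial.C (Polynomial.C (1 / 2 : ℂ)) * (nlsEps * nlsD (nlsCoef m).2.2) +
        MvPolynomial.X (NLSVar.r 0) * ((nlsCoef m).1 + if m = 0 then 1 else 0)))
decreasing_by all_goals omega

theorem nlsDSeries_add (f g : NLSPoly⟦X⟧) :
    nlsDSeries (f + g) = nlsDSeries f + nlsDSeries g := by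
  ext n; simp [nlsDSeries]

theorem nlsDSeries_neg (f : NLSPoly⟦X⟧) : nlsDSeries (-f) = -nlsDSeries f := by
  ext n; simp [nlsDSeries]

theorem nlsDSeries_two : nlsDSeries (2 : NLSPoly⟦X⟧) = 0 := by
  have : (2 : NLSPoly⟦X⟧) = C (2 : NLSPoly) := (map_ofNat C 2).symm
  rw [this]
  ext n
  simp only [nlsDSeries, coeff_mk, coeff_C]
  split_ifs
  · have : (2 : NLSPoly) = algebraMap (Polynomial ℂ) NLSPoly 2 := (map_ofNat _ 2).symm
    rw [this, Derivation.map_algebraMap]; simp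
  · simp

theorem nlsDSeries_mul (f g : NLSPoly⟦X⟧) :
    nlsDSeries (f * g) = nlsDSeries f * g + f * nlsDSeries g := by
  ext1 n
  simp only [nlsDSeries, coeff_mk, coeff_mul, map_add, map_sum, Derivation.leibniz, smul_eq_mul]
  rw [← Finset.sum_add_distrib]
  refine Finset.sum_congr rfl fun p _ => ?_
  ring

theorem X_pow_dvd_nlsDSeries {n : ℕ} {f : NLSPoly⟦X⟧} (h : (X : NLSPoly⟦X⟧) ^ n ∣ f) :
    (X : NLSPoly⟦X⟧) ^ n ∣ nlsDSeries f := by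
  rw [X_pow_dvd_iff] at h ⊢
  intro m hm
  simp [nlsDSeries, h m hm]

/-- The matrix conditions in terms of the entries. -/
theorem isNLSResolvent_iff (a b c : NLSPoly⟦X⟧) :
    IsNLSResolvent !![2 + a, b; c, -a] ↔
      (X ∣ a ∧ X ∣ b ∧ X ∣ c) ∧
      (C nlsEps * nlsDSeries a - C (MvPolynomial.X (NLSVar.r 0)) * b
        - C (MvPolynomial.X (NLSVar.q 0)) * c = 0) ∧
      2 * b = X * (C nlsEps * nlsDSeries b + 2 * C (MvPolynomial.X (NLSVar.q 0)) * (1 + a)) ∧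
      2 * c = -(X * (C nlsEps * nlsDSeries c + 2 * C (MvPolynomial.X (NLSVar.r 0)) * (1 + a))) ∧
      a ^ 2 + 2 * a + b * c = 0 := by
  have hX : (X : NLSPoly⟦X⟧) ≠ 0 := X_ne_zero
  have c2 : constantCoeff (2 : NLSPoly⟦X⟧) = 2 := map_ofNat _ 2
  constructor
  · rintro ⟨h1, h2, h3, h4⟩
    have e00 := congrFun (congrFun h2 0) 0
    have e01 := congrFun (congrFun h2 0) 1
    have e10 := congrFun (congrFun h2 1) 0
    have l00 := congrFun (congrFun h1 0) 0
    have l01 := congrFun (congrFun h1 0) 1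
    have l10 := congrFun (congrFun h1 1) 0
    rw [Matrix.det_fin_two] at h4
    simp [nlsU, nlsDSeries_add, nlsDSeries_two] at e00 e01 e10 l00 l01 l10 h4
    refine ⟨⟨X_dvd_iff.2 (by rw [c2] at l00; linear_combination l00), X_dvd_iff.2 l01, X_dvd_iff.2 l10⟩, ?_, ?_, ?_, ?_⟩
    · apply mul_left_cancel₀ hX
      linear_combination e00
    · linear_combination -e01
    · linear_combination e10
    · linear_combination -h4
  · rintro ⟨⟨l00, l01, l10⟩, ha, hb, hc, hn⟩
    rw [X_dvd_iff] at l00 l01 l10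
    refine ⟨?_, ?_, ?_, ?_⟩
    · ext i j
      fin_cases i <;> fin_cases j <;> simp [l00, l01, l10, c2]
    · refine Matrix.ext fun i j => ?_
      fin_cases i <;> fin_cases j <;>
        simp [nlsU, nlsDSeries_add, nlsDSeries_neg, nlsDSeries_two]
      · linear_combination X * ha
      · linear_combination -hb
      · linear_combination hc
      · linear_combination -X * ha
    · simp [Matrix.trace_fin_two]
    · rw [Matrix.det_fin_two]
      simp
      linear_combination -hn

theorem eq_of_nls_unique {ε q r a b c a' b' c' : NLSPoly⟦X⟧}
    (ha : X ∣ a) (hb : X ∣ b) (ha' : X ∣ a') (hc' : X ∣ c')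
    (h1 : 2 * b = X * (ε * nlsDSeries b + 2 * q * (1 + a)))
    (h2 : 2 * c = -(X * (ε * nlsDSeries c + 2 * r * (1 + a))))
    (h3 : a ^ 2 + 2 * a + b * c = 0)
    (h1' : 2 * b' = X * (ε * nlsDSeries b' + 2 * q * (1 + a')))
    (h2' : 2 * c' = -(X * (ε * nlsDSeries c' + 2 * r * (1 + a'))))
    (h3' : a' ^ 2 + 2 * a' + b' * c' = 0) : a = a' ∧ b = b' ∧ c = c' := by
  have two : IsUnit (2 : NLSPoly⟦X⟧) := by
    refine IsUnit.of_mul_eq_one (C (MvPolynomial.C (Polynomial.C (1 / 2 : ℂ)))) ?_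
    have : (2 : NLSPoly⟦X⟧) = C (MvPolynomial.C (Polynomial.C (2 : ℂ))) := by
      rw [map_ofNat Polynomial.C, map_ofNat MvPolynomial.C, map_ofNat C]
    rw [this, ← map_mul, ← map_mul, ← map_mul]
    norm_num
  have hD : ∀ f g : NLSPoly⟦X⟧, nlsDSeries (f - g) = nlsDSeries f - nlsDSeries g := by
    intro f g
    rw [sub_eq_add_neg, nlsDSeries_add, nlsDSeries_neg, sub_eq_add_neg]
  have main : ∀ n : ℕ, (X : NLSPoly⟦X⟧) ^ n ∣ a - a' ∧ (X : NLSPoly⟦X⟧) ^ n ∣ b - b' ∧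
      (X : NLSPoly⟦X⟧) ^ n ∣ c - c' := by
    intro n
    induction n with
    | zero => simp
    | succ n ih =>
      obtain ⟨ia, ib, ic⟩ := ih
      refine ⟨?_, ?_, ?_⟩
      · rw [← two.dvd_mul_left, pow_succ']
        have : 2 * (a - a') = -((a + a') * (a - a') + b * (c - c') + c' * (b - b')) := by
          linear_combination h3 - h3'
        rw [this]
        refine (dvd_add (dvd_add (mul_dvd_mul (dvd_add ha ha') ia) (mul_dvd_mul hb ic))
          (mul_dvd_mul hc' ib)).neg_right
      · rw [← two.dvd_mul_left, pow_succ']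
        have : 2 * (b - b') = X * (ε * nlsDSeries (b - b') + 2 * q * (a - a')) := by
          rw [hD]; linear_combination h1 - h1'
        rw [this]
        exact mul_dvd_mul_left _ (dvd_add (Dvd.dvd.mul_left (X_pow_dvd_nlsDSeries ib) _)
          (Dvd.dvd.mul_left ia _))
      · rw [← two.dvd_mul_left, pow_succ']
        have : 2 * (c - c') = X * -(ε * nlsDSeries (c - c') + 2 * r * (a - a')) := by
          rw [hD]; linear_combination h2 - h2'
        rw [this]
        exact mul_dvd_mul_left _ (dvd_add (Dvd.dvd.mul_left (X_pow_dvd_nlsDSeries ic) _)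
          (Dvd.dvd.mul_left ia _)).neg_right
  have fin : ∀ f g : NLSPoly⟦X⟧, (∀ n : ℕ, (X : NLSPoly⟦X⟧) ^ n ∣ f - g) → f = g := by
    intro f g h
    ext1 n
    have := X_pow_dvd_iff.1 (h (n + 1)) n (Nat.lt_succ_self n)
    rwa [map_sub, sub_eq_zero] at this
  exact ⟨fin _ _ fun n => (main n).1, fin _ _ fun n => (main n).2.1, fin _ _ fun n => (main n).2.2⟩

theorem existsUnique_isNLSResolvent :
    ∃! R : Matrix (Fin 2) (Fin 2) NLSPoly⟦X⟧, IsNLSResolvent R := by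
  refine existsUnique_of_exists_of_unique ?_ ?_
  · set a : NLSPoly⟦X⟧ := PowerSeries.mk fun n => (nlsCoef n).1 with ha
    set b : NLSPoly⟦X⟧ := PowerSeries.mk fun n => (nlsCoef n).2.1 with hb
    set c : NLSPoly⟦X⟧ := PowerSeries.mk fun n => (nlsCoef n).2.2 with hc
    have z : nlsCoef 0 = 0 := by rw [nlsCoef]
    have two : (2 : NLSPoly) * MvPolynomial.C (Polynomial.C (1 / 2 : ℂ)) = 1 := by
      have : (2 : NLSPoly) = MvPolynomial.C (Polynomial.C (2 : ℂ)) := by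
        rw [map_ofNat Polynomial.C, map_ofNat MvPolynomial.C]
      rw [this, ← map_mul, ← map_mul]
      norm_num
    have two' : (2 : NLSPoly⟦X⟧) = C (2 : NLSPoly) := (map_ofNat C 2).symm
    have h1 : 2 * b = X * (C nlsEps * nlsDSeries b +
        2 * C (MvPolynomial.X (NLSVar.q 0)) * (1 + a)) := by
      rw [two', mul_assoc]
      ext1 n
      rcases n with _ | m
      · simp [hb, z]
      · simp only [hb, ha, nlsDSeries, coeff_succ_X_mul, coeff_mk, map_add, coeff_C_mul, coeff_one]
        conv_lhs => rw [nlsCoef]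
        linear_combination (nlsEps * nlsD (nlsCoef m).2.1) * two
    have h2 : 2 * c = -(X * (C nlsEps * nlsDSeries c +
        2 * C (MvPolynomial.X (NLSVar.r 0)) * (1 + a))) := by
      rw [two', mul_assoc]
      ext1 n
      rcases n with _ | m
      · simp [hc, z]
      · simp only [hc, ha, nlsDSeries, coeff_succ_X_mul, coeff_mk, map_add, map_neg, coeff_C_mul,
          coeff_one]
        conv_lhs => rw [nlsCoef]
        linear_combination -(nlsEps * nlsD (nlsCoef m).2.2) * two
    have h3 : a ^ 2 + 2 * a + b * c = 0 := by
      rw [two']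
      ext1 n
      rcases n with _ | m
      · simp [ha, hb, hc, z, pow_two]
      · have hsum : ∀ f g : ℕ → NLSPoly, f 0 = 0 → g 0 = 0 →
            coeff (m + 1) (PowerSeries.mk f * PowerSeries.mk g) =
              ∑ i : Fin m, f (i + 1) * g (m - i) := by
          intro f g hf hg
          rw [coeff_mul, Finset.Nat.sum_antidiagonal_eq_sum_range_succ_mk, Finset.sum_range_succ,
            Finset.sum_range_succ', Fin.sum_univ_eq_sum_range (fun i => f (i + 1) * g (m - i))]
          simp [hf, hg]
        rw [pow_two, map_add, map_add, hsum _ _ (by simp [z]) (by simp [z]),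
          hsum _ _ (by simp [z]) (by simp [z]), coeff_C_mul, ha, coeff_mk, nlsCoef,
          Finset.sum_add_distrib, map_zero]
        linear_combination -(∑ i : Fin m, (nlsCoef (i + 1)).1 * (nlsCoef (m - i)).1 +
          ∑ i : Fin m, (nlsCoef (i + 1)).2.1 * (nlsCoef (m - i)).2.2) * two
    have Xa : X ∣ a := X_dvd_iff.2 (by simp [ha, ← coeff_zero_eq_constantCoeff_apply, z])
    have Xb : X ∣ b := X_dvd_iff.2 (by simp [hb, ← coeff_zero_eq_constantCoeff_apply, z])
    have Xc : X ∣ c := X_dvd_iff.2 (by simp [hc, ← coeff_zero_eq_constantCoeff_apply, z])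
    refine ⟨!![2 + a, b; c, -a], (isNLSResolvent_iff a b c).2 ⟨⟨Xa, Xb, Xc⟩, ?_, h1, h2, h3⟩⟩
    have d := congrArg nlsDSeries h3
    have z' : nlsDSeries 0 = 0 := by ext n; simp [nlsDSeries]
    rw [pow_two, nlsDSeries_add, nlsDSeries_add, nlsDSeries_mul, nlsDSeries_mul, nlsDSeries_mul,
      nlsDSeries_two, z'] at d
    have hne : (2 * (1 + a) * X : NLSPoly⟦X⟧) ≠ 0 := by
      refine mul_ne_zero (mul_ne_zero (by rw [two']; intro h; have := congrArg constantCoeff h; simp at this) ?_) X_ne_zero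
      intro h
      have := congrArg constantCoeff h
      rw [map_add, X_dvd_iff.1 Xa] at this
      simp at this
    apply mul_left_cancel₀ hne
    linear_combination (X * C nlsEps) * d + c * h1 - b * h2
  · intro R R' hR hR'
    have form : ∀ S : Matrix (Fin 2) (Fin 2) NLSPoly⟦X⟧, IsNLSResolvent S →
        S = !![2 + (S 0 0 - 2), S 0 1; S 1 0, -(S 0 0 - 2)] := by
      intro S hS
      have := hS.trace
      rw [Matrix.trace_fin_two] at this
      refine Matrix.ext fun i j => ?_
      fin_cases i <;> fin_cases j <;> simp
      linear_combination this
    have e := form R hR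
    have e' := form R' hR'
    rw [e] at hR
    rw [e'] at hR'
    obtain ⟨⟨p1, p2, -⟩, -, p5, p6, p7⟩ := (isNLSResolvent_iff _ _ _).1 hR
    obtain ⟨⟨s1, -, s3⟩, -, s5, s6, s7⟩ := (isNLSResolvent_iff _ _ _).1 hR'
    obtain ⟨k1, k2, k3⟩ := eq_of_nls_unique p1 p2 s1 s3 p5 p6 p7 s5 s6 s7
    rw [e, e', k1, k2, k3]

/-- The basic matrix resolvent `R^NLS(ξ)`, a series in `X = ξ⁻¹`. -/
def nlsResolvent : Matrix (Fin 2) (Fin 2) NLSPoly⟦X⟧ := existsUnique_isNLSResolvent.choose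

theorem isNLSResolvent_nlsResolvent : IsNLSResolvent nlsResolvent :=
  existsUnique_isNLSResolvent.choose_spec.1

/-- `B_j`, the coefficient of `ξ^(-j-1)` in the upper right entry. -/
def nlsB (j : ℕ) : NLSPoly := coeff (j + 1) (nlsResolvent 0 1)

/-- `C_j`, the coefficient of `ξ^(-j-1)` in the lower left entry. -/
def nlsC (j : ℕ) : NLSPoly := coeff (j + 1) (nlsResolvent 1 0)

theorem existsUnique_nlsTwoPoint : ∃! Ω : ℕ → ℕ → NLSPoly, IsTwoPoint nlsResolvent (2 ^ 2) Ω :=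
  existsUnique_isTwoPoint nlsResolvent 2
    (isNLSResolvent_nlsResolvent.trace.trans (map_ofNat C 2).symm) isNLSResolvent_nlsResolvent.det

/-- The tau-structure `Ω^NLS_{i,j}`, given by
`∑ 2^(-i-j) Ω_{i,j} ξ^(-i-2) ν^(-j-2) = (tr R(ξ) R(ν) - 4) / (ξ - ν)^2`. -/
def nlsOmega (i j : ℕ) : NLSPoly := 2 ^ (i + j) * existsUnique_nlsTwoPoint.choose i j

/-- The value of an element of `𝒜[ε]` for given values of `ε` and of the jets `q_i`, `r_i`. -/
def nlsEval {A : Type*} [CommRing A] [Algebra ℂ A] (ε : A) (q r : ℕ → A) : NLSPoly →+* A :=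
  MvPolynomial.eval₂Hom (Polynomial.aeval ε : Polynomial ℂ →ₐ[ℂ] A).toRingHom fun
    | NLSVar.q i => q i
    | NLSVar.r i => r i

/-! ### The Toda lattice hierarchy -/

/-- The variables `v_k`, `w_k`, `k ∈ ℤ`. -/
inductive TodaVar : Type
  | v (k : ℤ)
  | w (k : ℤ)

/-- The ring `ℤ[𝐯, 𝐰]`. -/
abbrev TodaPoly : Type := MvPolynomial TodaVar ℤ

/-- The power `Λ^m` of the shift operator `v_k ↦ v_{k+1}`, `w_k ↦ w_{k+1}`. -/
def todaShift (m : ℤ) : TodaPoly →+* TodaPoly :=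
  (MvPolynomial.rename fun
    | TodaVar.v k => TodaVar.v (k + m)
    | TodaVar.w k => TodaVar.w (k + m)).toRingHom

/-- `λ⁻¹ U(λ)`, where `U(λ) = !![v - λ, w; -1, 0]` and `X` stands for `λ⁻¹`. -/
def todaU : Matrix (Fin 2) (Fin 2) TodaPoly⟦X⟧ :=
  !![X * C (MvPolynomial.X (TodaVar.v 0)) - 1, X * C (MvPolynomial.X (TodaVar.w 0)); -X, 0]

/-- `R` is a basic matrix resolvent of `Λ + U(λ)`: `R = diag(1,0) + O(λ⁻¹)`,
`Λ(R) U(λ) - U(λ) R = 0` (written after multiplication by `λ⁻¹`), `tr R = 1`, `det R = 0`. -/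
structure IsTodaResolvent (R : Matrix (Fin 2) (Fin 2) TodaPoly⟦X⟧) : Prop where
  leading : R.map (constantCoeff (R := TodaPoly)) = !![1, 0; 0, 0]
  comm : R.map (PowerSeries.map (todaShift 1)) * todaU - todaU * R = 0
  trace : R.trace = 1
  det : R.det = 0

theorem todaShift_todaShift (m n : ℤ) (p : TodaPoly) :
    todaShift m (todaShift n p) = todaShift (n + m) p := by
  simp only [todaShift, AlgHom.toRingHom_eq_coe, RingHom.coe_coe, MvPolynomial.rename_rename]
  congr 2
  funext k
  cases k <;> simp [add_assoc]

theorem todaShift_zero (p : TodaPoly) : todaShift 0 p = p := by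
  simp only [todaShift, AlgHom.toRingHom_eq_coe, RingHom.coe_coe]
  convert MvPolynomial.rename_id_apply p using 2
  congr 1
  funext k
  cases k <;> simp

theorem todaShift_v (m k : ℤ) :
    todaShift m (MvPolynomial.X (TodaVar.v k)) = MvPolynomial.X (TodaVar.v (k + m)) := by
  simp [todaShift]

theorem todaShift_w (m k : ℤ) :
    todaShift m (MvPolynomial.X (TodaVar.w k)) = MvPolynomial.X (TodaVar.w (k + m)) := by
  simp [todaShift]

/-- Recursive computation of the coefficients of the entries `α`, `γ` of the resolvent. -/
def todaCoef : ℕ → TodaPoly × TodaPoly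
  | 0 => 0
  | m + 1 =>
    (∑ i : Fin m, (MvPolynomial.X (TodaVar.w 0) *
        ((todaCoef (i + 1)).2 * todaShift 1 (todaCoef (m - i)).2) -
          (todaCoef (i + 1)).1 * (todaCoef (m - i)).1),
      MvPolynomial.X (TodaVar.v (-1)) * (todaCoef m).2 + (todaCoef m).1 +
        todaShift (-1) (todaCoef m).1 + if m = 0 then 1 else 0)
decreasing_by all_goals omega

/-- The matrix conditions in terms of the entries. -/
theorem isTodaResolvent_iff (a b c : TodaPoly⟦X⟧) :
    IsTodaResolvent !![1 + a, b; c, -a] ↔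
      (X ∣ a ∧ X ∣ b ∧ X ∣ c) ∧
      b = -(C (MvPolynomial.X (TodaVar.w 0)) * PowerSeries.map (todaShift 1) c) ∧
      PowerSeries.map (todaShift 1) c = X * (C (MvPolynomial.X (TodaVar.v 0)) *
        PowerSeries.map (todaShift 1) c + 1 + a + PowerSeries.map (todaShift 1) a) ∧
      (1 - X * C (MvPolynomial.X (TodaVar.v 0))) * (PowerSeries.map (todaShift 1) a - a) =
        X * (C (MvPolynomial.X (TodaVar.w 0)) * -c - PowerSeries.map (todaShift 1) b) ∧
      a ^ 2 + a + b * c = 0 := by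
  have hX : (X : TodaPoly⟦X⟧) ≠ 0 := X_ne_zero
  constructor
  · rintro ⟨h1, h2, h3, h4⟩
    have e00 := congrFun (congrFun h2 0) 0
    have e01 := congrFun (congrFun h2 0) 1
    have e10 := congrFun (congrFun h2 1) 0
    have e11 := congrFun (congrFun h2 1) 1
    have l00 := congrFun (congrFun h1 0) 0
    have l01 := congrFun (congrFun h1 0) 1
    have l10 := congrFun (congrFun h1 1) 0
    rw [Matrix.det_fin_two] at h4
    simp [todaU, Matrix.mul_apply, Fin.sum_univ_two] at e00 e01 e10 e11 l00 l01 l10 h4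
    refine ⟨⟨X_dvd_iff.2 l00, X_dvd_iff.2 l01, X_dvd_iff.2 l10⟩, ?_, ?_, ?_, ?_⟩
    · apply mul_left_cancel₀ hX
      linear_combination e11
    · linear_combination -e10
    · linear_combination -e00
    · linear_combination -h4
  · rintro ⟨⟨l00, l01, l10⟩, hb, hc, ha, hn⟩
    rw [X_dvd_iff] at l00 l01 l10
    refine ⟨?_, ?_, ?_, ?_⟩
    · refine Matrix.ext fun i j => ?_
      fin_cases i <;> fin_cases j <;> simp [l00, l01, l10]
    · refine Matrix.ext fun i j => ?_
      fin_cases i <;> fin_cases j <;>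
        simp [todaU, Matrix.mul_apply, Fin.sum_univ_two]
      · linear_combination -ha
      · linear_combination -(C (MvPolynomial.X (TodaVar.w 0))) * hc +
          (1 - X * C (MvPolynomial.X (TodaVar.v 0))) * hb
      · linear_combination -hc
      · linear_combination X * hb
    · simp [Matrix.trace_fin_two]
    · rw [Matrix.det_fin_two]
      simp
      linear_combination -hn

theorem X_pow_dvd_map_todaShift {n : ℕ} {m : ℤ} {f : TodaPoly⟦X⟧} :
    (X : TodaPoly⟦X⟧) ^ n ∣ PowerSeries.map (todaShift m) f ↔ (X : TodaPoly⟦X⟧) ^ n ∣ f := by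
  simp only [X_pow_dvd_iff, coeff_map]
  refine forall₂_congr fun k _ => ⟨fun h => ?_, fun h => by rw [h, map_zero]⟩
  have := congrArg (todaShift (-m)) h
  rwa [todaShift_todaShift, add_neg_cancel, todaShift_zero, map_zero] at this

theorem eq_of_toda_unique {v w a c a' c' : TodaPoly⟦X⟧}
    (ha : X ∣ a) (ha' : X ∣ a') (hc' : X ∣ c')
    (h1 : PowerSeries.map (todaShift 1) c =
      X * (v * PowerSeries.map (todaShift 1) c + 1 + a + PowerSeries.map (todaShift 1) a))
    (h2 : a ^ 2 + a + -(w * PowerSeries.map (todaShift 1) c) * c = 0)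
    (h1' : PowerSeries.map (todaShift 1) c' =
      X * (v * PowerSeries.map (todaShift 1) c' + 1 + a' + PowerSeries.map (todaShift 1) a'))
    (h2' : a' ^ 2 + a' + -(w * PowerSeries.map (todaShift 1) c') * c' = 0) :
    a = a' ∧ c = c' := by
  have main : ∀ n : ℕ, (X : TodaPoly⟦X⟧) ^ n ∣ a - a' ∧ (X : TodaPoly⟦X⟧) ^ n ∣ c - c' := by
    intro n
    induction n with
    | zero => simp
    | succ n ih =>
      obtain ⟨ia, ic⟩ := ih
      have ja := X_pow_dvd_map_todaShift (m := 1).2 ia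
      have jc := X_pow_dvd_map_todaShift (m := 1).2 ic
      have kc : X ∣ PowerSeries.map (todaShift 1) c := by
        rw [h1]; exact dvd_mul_right _ _
      refine ⟨?_, ?_⟩
      · rw [pow_succ']
        have : a - a' = -((a + a') * (a - a')) + w * (PowerSeries.map (todaShift 1) c * (c - c') +
            c' * PowerSeries.map (todaShift 1) (c - c')) := by
          rw [map_sub]; linear_combination h2 - h2'
        rw [this]
        exact dvd_add (mul_dvd_mul (dvd_add ha ha') ia).neg_right
          (Dvd.dvd.mul_left (dvd_add (mul_dvd_mul kc ic) (mul_dvd_mul hc' jc)) _)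
      · rw [← X_pow_dvd_map_todaShift (m := 1), pow_succ']
        have : PowerSeries.map (todaShift 1) (c - c') = X * (v *
            PowerSeries.map (todaShift 1) (c - c') + (a - a') +
              PowerSeries.map (todaShift 1) (a - a')) := by
          simp only [map_sub]; linear_combination h1 - h1'
        rw [this]
        exact mul_dvd_mul_left _ (dvd_add (dvd_add (Dvd.dvd.mul_left jc _) ia) ja)
  have fin : ∀ f g : TodaPoly⟦X⟧, (∀ n : ℕ, (X : TodaPoly⟦X⟧) ^ n ∣ f - g) → f = g := by
    intro f g h
    ext1 n
    have := X_pow_dvd_iff.1 (h (n + 1)) n (Nat.lt_succ_self n)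
    rwa [map_sub, sub_eq_zero] at this
  exact ⟨fin _ _ fun n => (main n).1, fin _ _ fun n => (main n).2⟩

theorem existsUnique_isTodaResolvent :
    ∃! R : Matrix (Fin 2) (Fin 2) TodaPoly⟦X⟧, IsTodaResolvent R := by
  refine existsUnique_of_exists_of_unique ?_ ?_
  · set a : TodaPoly⟦X⟧ := PowerSeries.mk fun n => (todaCoef n).1 with ha
    set c : TodaPoly⟦X⟧ := PowerSeries.mk fun n => (todaCoef n).2 with hc
    set b : TodaPoly⟦X⟧ :=
      -(C (MvPolynomial.X (TodaVar.w 0)) * PowerSeries.map (todaShift 1) c) with hb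
    have z : todaCoef 0 = 0 := by rw [todaCoef]
    have h1 : PowerSeries.map (todaShift 1) c = X * (C (MvPolynomial.X (TodaVar.v 0)) *
        PowerSeries.map (todaShift 1) c + 1 + a + PowerSeries.map (todaShift 1) a) := by
      ext1 n
      rcases n with _ | m
      · simp [hc, z]
      · simp only [hc, ha, coeff_succ_X_mul, coeff_mk, map_add, coeff_C_mul, coeff_one, coeff_map]
        conv_lhs => rw [todaCoef]
        simp only [map_add, map_mul, todaShift_v, todaShift_todaShift, neg_add_cancel,
          todaShift_zero]
        split_ifs <;> simp <;> ring
    have h3 : a ^ 2 + a + b * c = 0 := by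
      have : a = C (MvPolynomial.X (TodaVar.w 0)) * (c * PowerSeries.map (todaShift 1) c) -
          a * a := by
        ext1 n
        rcases n with _ | m
        · simp [ha, hc, z]
        · have hsum : ∀ f g : ℕ → TodaPoly, f 0 = 0 → g 0 = 0 →
              coeff (m + 1) (PowerSeries.mk f * PowerSeries.mk g) =
                ∑ i : Fin m, f (i + 1) * g (m - i) := by
            intro f g hf hg
            rw [coeff_mul, Finset.Nat.sum_antidiagonal_eq_sum_range_succ_mk, Finset.sum_range_succ,
              Finset.sum_range_succ', Fin.sum_univ_eq_sum_range (fun i => f (i + 1) * g (m - i))]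
            simp [hf, hg]
          have hm : PowerSeries.map (todaShift 1) c =
              PowerSeries.mk fun n => todaShift 1 (todaCoef n).2 := by
            ext1 n; simp [hc]
          rw [hm, map_sub, coeff_C_mul, hc, hsum _ _ (by simp [z]) (by simp [z]), ha,
            hsum _ _ (by simp [z]) (by simp [z]), coeff_mk, todaCoef, Finset.sum_sub_distrib,
            Finset.mul_sum]
      rw [hb]
      linear_combination this
    have Xa : X ∣ a := X_dvd_iff.2 (by simp [ha, ← coeff_zero_eq_constantCoeff_apply, z])
    have Xc : X ∣ c := X_dvd_iff.2 (by simp [hc, ← coeff_zero_eq_constantCoeff_apply, z])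
    have Xc' : X ∣ PowerSeries.map (todaShift 1) c := by rw [h1]; exact dvd_mul_right _ _
    have Xb : X ∣ b := (Dvd.dvd.mul_left Xc' _).neg_right
    refine ⟨!![1 + a, b; c, -a], (isTodaResolvent_iff a b c).2 ⟨⟨Xa, Xb, Xc⟩, hb, h1, ?_, h3⟩⟩
    have d := congrArg (PowerSeries.map (todaShift 1)) h3
    simp only [map_add, map_pow, map_mul, map_zero] at d
    have hne : PowerSeries.map (todaShift 1) c ≠ 0 := by
      intro h
      have := congrArg (coeff 1) h
      rw [coeff_map, hc, coeff_mk, todaCoef, z] at this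
      simp at this
    apply mul_left_cancel₀ hne
    linear_combination X * d - X * h3 + (PowerSeries.map (todaShift 1) a - a) * h1 +
      X * c * hb
  · intro R R' hR hR'
    have form : ∀ S : Matrix (Fin 2) (Fin 2) TodaPoly⟦X⟧, IsTodaResolvent S →
        S = !![1 + (S 0 0 - 1), S 0 1; S 1 0, -(S 0 0 - 1)] := by
      intro S hS
      have := hS.trace
      rw [Matrix.trace_fin_two] at this
      refine Matrix.ext fun i j => ?_
      fin_cases i <;> fin_cases j <;> simp
      linear_combination this
    have e := form R hR
    have e' := form R' hR'
    rw [e] at hR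
    rw [e'] at hR'
    obtain ⟨⟨p1, -, -⟩, p4, p5, -, p7⟩ := (isTodaResolvent_iff _ _ _).1 hR
    obtain ⟨⟨s1, -, s3⟩, s4, s5, -, s7⟩ := (isTodaResolvent_iff _ _ _).1 hR'
    rw [p4] at p7
    rw [s4] at s7
    obtain ⟨k1, k2⟩ := eq_of_toda_unique p1 s1 s3 p5 p7 s5 s7
    rw [e, e', p4, s4, k1, k2]

/-- The basic matrix resolvent `R(λ)` of the Toda lattice, a series in `X = λ⁻¹`. -/
def todaResolvent : Matrix (Fin 2) (Fin 2) TodaPoly⟦X⟧ := existsUnique_isTodaResolvent.choose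

theorem isTodaResolvent_todaResolvent : IsTodaResolvent todaResolvent :=
  existsUnique_isTodaResolvent.choose_spec.1

/-- `a_j`, the coefficient of `λ^(-j-1)` in the upper left entry. -/
def todaA (j : ℕ) : TodaPoly := coeff (j + 1) (todaResolvent 0 0)

/-- `c_j`, the coefficient of `λ^(-j-1)` in the lower left entry (so `c_0 = 1`). -/
def todaC (j : ℕ) : TodaPoly := coeff (j + 1) (todaResolvent 1 0)

theorem existsUnique_todaTwoPoint :
    ∃! Ω : ℕ → ℕ → TodaPoly, IsTwoPoint todaResolvent (1 ^ 2) Ω :=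
  existsUnique_isTwoPoint todaResolvent 1
    (isTodaResolvent_todaResolvent.trace.trans (map_one C).symm) isTodaResolvent_todaResolvent.det

/-- The tau-structure `Ω_{i,j}`, given by
`∑ Ω_{i,j} λ^(-i-2) μ^(-j-2) = (tr R(λ) R(μ) - 1) / (λ - μ)^2`. -/
def todaOmega (i j : ℕ) : TodaPoly := existsUnique_todaTwoPoint.choose i j

/-- The value of an element of `ℤ[𝐯, 𝐰]` for given values of `v_k`, `w_k`. -/
def todaEval {A : Type*} [CommRing A] (v w : ℤ → A) : TodaPoly →+* A :=
  MvPolynomial.eval₂Hom (Int.castRingHom A) fun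
    | TodaVar.v k => v k
    | TodaVar.w k => w k

/-! ### Solutions and tau-functions: functions of the times

The times `t = (t₀, t₁, …)` form an element of `ℕ → 𝕜`, where `𝕜` is `ℝ` or `ℂ`.
Functions are complex-valued; only their values on a given domain matter. -/

section Functions

variable {𝕜 : Type*} [RCLike 𝕜]

/-- The point `t` with its first `n` coordinates moved by `s`. -/
def moveTimes (t : ℕ → 𝕜) {n : ℕ} (s : Fin n → 𝕜) : ℕ → 𝕜 :=
  fun k => if h : k < n then t k + s ⟨k, h⟩ else t k

/-- `U` is open in the directions of any finitely many times. (Every open set of the product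
topology is of this kind, and so is, for instance, the set of finitely supported sequences.) -/
def IsTimeDomain (U : Set (ℕ → 𝕜)) : Prop :=
  ∀ t ∈ U, ∀ n : ℕ, ∀ᶠ s : Fin n → 𝕜 in nhds 0, moveTimes t s ∈ U

variable [NormedAlgebra 𝕜 ℂ]

/-- `f` is smooth on `U` as a function of any finitely many times. -/
def SmoothInTimes (U : Set (ℕ → 𝕜)) (f : (ℕ → 𝕜) → ℂ) : Prop :=
  ∀ t ∈ U, ∀ n : ℕ, ContDiffAt 𝕜 ((⊤ : ℕ∞) : WithTop ℕ∞) (fun s : Fin n → 𝕜 => f (moveTimes t s)) 0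

/-- The partial derivative `∂f/∂t_j`. -/
def timeDeriv (j : ℕ) (f : (ℕ → 𝕜) → ℂ) (t : ℕ → 𝕜) : ℂ :=
  deriv (fun s : 𝕜 => f (Function.update t j s)) (t j)

/-- `(q, r)` is a solution on `U` of the NLS hierarchy
`ε ∂q/∂t_j = 2^(j+1) B_{j+1}`, `ε ∂r/∂t_j = 2^(j+1) C_{j+1}`, with `∂_X = ∂/∂t₀`. -/
structure IsNLSSolutionOn (ε : ℂ) (U : Set (ℕ → 𝕜)) (q r : (ℕ → 𝕜) → ℂ) : Prop where
  smooth_q : SmoothInTimes U q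
  smooth_r : SmoothInTimes U r
  flow_q : ∀ t ∈ U, ∀ j : ℕ, ε * timeDeriv j q t = 2 ^ (j + 1) *
    nlsEval ε (fun i => (timeDeriv 0)^[i] q t) (fun i => (timeDeriv 0)^[i] r t) (nlsB (j + 1))
  flow_r : ∀ t ∈ U, ∀ j : ℕ, ε * timeDeriv j r t = 2 ^ (j + 1) *
    nlsEval ε (fun i => (timeDeriv 0)^[i] q t) (fun i => (timeDeriv 0)^[i] r t) (nlsC (j + 1))

/-- `τ` is a (nowhere vanishing) tau-function on `U` of the solution `(q, r)` of the NLS hierarchy: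
`ε² ∂²(log τ)/∂t_i∂t_j = Ω^NLS_{i,j}`. Here `∂_j log τ` is written as `(∂_j τ)/τ`. -/
structure IsNLSTauOn (ε : ℂ) (U : Set (ℕ → 𝕜)) (q r τ : (ℕ → 𝕜) → ℂ) : Prop where
  smooth : SmoothInTimes U τ
  ne_zero : ∀ t ∈ U, τ t ≠ 0
  two_point : ∀ t ∈ U, ∀ i j : ℕ, ε ^ 2 * timeDeriv i (fun t' => timeDeriv j τ t' / τ t') t =
    nlsEval ε (fun i => (timeDeriv 0)^[i] q t) (fun i => (timeDeriv 0)^[i] r t) (nlsOmega i j)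

/-- `D` is a domain for functions of `(x, t)`: it is invariant under `x ↦ x + ε`, and its slices
at fixed `x` are open in the directions of any finitely many times. -/
structure IsLatticeDomain (ε : ℂ) (D : Set (ℂ × (ℕ → 𝕜))) : Prop where
  shift : ∀ x t, (x + ε, t) ∈ D ↔ (x, t) ∈ D
  slice : ∀ x, IsTimeDomain {t | (x, t) ∈ D}

/-- The value at `(x, t)` of an element of `ℤ[𝐯, 𝐰]`, with `v_k = v(x + kε, t)`,
`w_k = w(x + kε, t)`. -/
def todaValue (ε : ℂ) (v w : ℂ → (ℕ → 𝕜) → ℂ) (x : ℂ) (t : ℕ → 𝕜) : TodaPoly →+* ℂ :=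
  todaEval (fun k => v (x + k * ε) t) (fun k => w (x + k * ε) t)

/-- `(v, w)` is a solution on `D` of the Toda lattice hierarchy
`∂v/∂t_j = ε⁻¹ (Λ - 1)(a_{j+1})`, `∂w/∂t_j = ε⁻¹ w (Λ - 1)(c_{j+1})`. -/
structure IsTodaSolutionOn (ε : ℂ) (D : Set (ℂ × (ℕ → 𝕜))) (v w : ℂ → (ℕ → 𝕜) → ℂ) : Prop where
  smooth_v : ∀ x, SmoothInTimes {t | (x, t) ∈ D} (v x)
  smooth_w : ∀ x, SmoothInTimes {t | (x, t) ∈ D} (w x)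
  flow_v : ∀ x t, (x, t) ∈ D → ∀ j : ℕ, timeDeriv j (v x) t =
    ε⁻¹ * todaValue ε v w x t (todaShift 1 (todaA (j + 1)) - todaA (j + 1))
  flow_w : ∀ x t, (x, t) ∈ D → ∀ j : ℕ, timeDeriv j (w x) t =
    ε⁻¹ * w x t * todaValue ε v w x t (todaShift 1 (todaC (j + 1)) - todaC (j + 1))

/-- `τ` is a (nowhere vanishing) tau-function on `D` of the solution `(v, w)` of the Toda lattice
hierarchy: `ε² ∂²(log τ)/∂t_i∂t_j = Ω_{i,j}`, `ε ∂_i log(τ(x+ε)/τ(x)) = Λ(c_{i+1})`,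
`τ(x+ε) τ(x-ε) / τ(x)² = w(x)`. Logarithmic derivatives are written as `(∂_j τ)/τ`. -/
structure IsTodaTauOn (ε : ℂ) (D : Set (ℂ × (ℕ → 𝕜))) (v w τ : ℂ → (ℕ → 𝕜) → ℂ) : Prop where
  smooth : ∀ x, SmoothInTimes {t | (x, t) ∈ D} (τ x)
  ne_zero : ∀ x t, (x, t) ∈ D → τ x t ≠ 0
  two_point : ∀ x t, (x, t) ∈ D → ∀ i j : ℕ,
    ε ^ 2 * timeDeriv i (fun t' => timeDeriv j (τ x) t' / τ x t') t =
      todaValue ε v w x t (todaOmega i j)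
  one_point : ∀ x t, (x, t) ∈ D → ∀ i : ℕ,
    ε * (timeDeriv i (fun t' => τ (x + ε) t' / τ x t') t / (τ (x + ε) t / τ x t)) =
      todaValue ε v w x t (todaShift 1 (todaC (i + 1)))
  toda : ∀ x t, (x, t) ∈ D → τ (x + ε) t * τ (x - ε) t / τ x t ^ 2 = w x t

end Functions

/-! ### Solutions and tau-functions: formal setting

Formal solutions live in a commutative `ℂ`-algebra `A` of "functions" of `x`, `t` and `ε` (formal
power or Laurent series, for instance), with the derivations `∂_j = ∂/∂t_j` and the automorphism
`Λ : x ↦ x + ε`. -/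

section Formal

variable {A : Type*} [CommRing A] [Algebra ℂ A]

/-- `A` with `∂_j = ∂/∂t_j`, the shift `Λ` and the invertible element `ε` is an algebra of
functions of `x`, `t`, `ε`: the derivations commute with each other and with `Λ`, and `ε` is
constant. -/
structure IsLatticeAlgebra (d : ℕ → Derivation ℂ A A) (Λ : A ≃ₐ[ℂ] A) (ε : Aˣ) : Prop where
  comm : ∀ i j f, d i (d j f) = d j (d i f)
  shift : ∀ j f, d j (Λ f) = Λ (d j f)
  d_eps : ∀ j, d j (ε : A) = 0
  shift_eps : Λ (ε : A) = ε

/-- Formal solutions of the NLS hierarchy. -/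
structure IsFormalNLSSolution (d : ℕ → Derivation ℂ A A) (ε : Aˣ) (q r : A) : Prop where
  flow_q : ∀ j : ℕ, ε * d j q = 2 ^ (j + 1) *
    nlsEval (ε : A) (fun i => (d 0)^[i] q) (fun i => (d 0)^[i] r) (nlsB (j + 1))
  flow_r : ∀ j : ℕ, ε * d j r = 2 ^ (j + 1) *
    nlsEval (ε : A) (fun i => (d 0)^[i] q) (fun i => (d 0)^[i] r) (nlsC (j + 1))

/-- Formal tau-functions of a solution of the NLS hierarchy. -/
def IsFormalNLSTau (d : ℕ → Derivation ℂ A A) (ε : Aˣ) (q r : A) (τ : Aˣ) : Prop :=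
  ∀ i j : ℕ, (ε : A) ^ 2 * d i (d j (τ : A) * (↑τ⁻¹ : A)) =
    nlsEval (ε : A) (fun i => (d 0)^[i] q) (fun i => (d 0)^[i] r) (nlsOmega i j)

/-- The value of an element of `ℤ[𝐯, 𝐰]`, with `v_k = Λ^k v`, `w_k = Λ^k w`. -/
def formalTodaValue (Λ : A ≃ₐ[ℂ] A) (v w : A) : TodaPoly →+* A :=
  todaEval (fun k => (Λ ^ k) v) (fun k => (Λ ^ k) w)

/-- Formal solutions of the Toda lattice hierarchy. -/
structure IsFormalTodaSolution (d : ℕ → Derivation ℂ A A) (Λ : A ≃ₐ[ℂ] A) (ε : Aˣ) (v w : A) :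
    Prop where
  flow_v : ∀ j : ℕ, d j v =
    (↑ε⁻¹ : A) * formalTodaValue Λ v w (todaShift 1 (todaA (j + 1)) - todaA (j + 1))
  flow_w : ∀ j : ℕ, d j w =
    (↑ε⁻¹ : A) * w * formalTodaValue Λ v w (todaShift 1 (todaC (j + 1)) - todaC (j + 1))

/-- Formal tau-functions of a solution of the Toda lattice hierarchy. -/
structure IsFormalTodaTau (d : ℕ → Derivation ℂ A A) (Λ : A ≃ₐ[ℂ] A) (ε : Aˣ) (v w : A) (τ : Aˣ) :
    Prop where
  two_point : ∀ i j : ℕ, (ε : A) ^ 2 * d i (d j (τ : A) * (↑τ⁻¹ : A)) =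
    formalTodaValue Λ v w (todaOmega i j)
  one_point : ∀ i : ℕ,
    ε * (d i (Λ τ * (↑τ⁻¹ : A)) * (τ * Λ (↑τ⁻¹ : A))) =
      formalTodaValue Λ v w (todaShift 1 (todaC (i + 1)))
  toda : Λ τ * Λ.symm τ * (↑τ⁻¹ : A) ^ 2 = w

end Formal

end TodaNLS
end

noncomputable section

namespace TodaNLS

open PowerSeries

/-! The basic Toda resolvent, taken at `λ = 2ξ` and gauge-transformed, is the basic AKNS resolvent.
Write the Toda resolvent as `!![1 + α, -w Λγ; γ, -α]`. The `t₀`-flow of Toda is `ε ∂v_k = w_{k+1} -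
w_k`, `ε ∂w_k = w_k (v_k - v_{k-1})`, and it acts on the resolvent by `ε ∂α = w (Λγ - γ)` and `ε ∂γ
= α - Λ⁻¹α` (`todaFlow_resolvent`). The tau-function relations give `ε ∂q = v q`, `ε ∂r = -v_{-1} r`
and `q r = w`; these three identities and the first flow are all that the comparison of resolvents
needs, and `IsTodaNLSPair` records them.

For such data the matrix `2 !![1 + α, q Λγ; -r γ, -α]` at `λ = 2ξ` satisfies the off-diagonal
commutator equations and the determinant equation of the AKNS resolvent. These equations have a
unique solution over any `ℂ`-algebra with a derivation (`eq_of_akns_unique`), so the matrix is the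
value of `nlsResolvent` (`IsTodaNLSPair.map_nlsResolvent`).

All claims are read off from this equality. The off-diagonal coefficients are `2^(j+1) B_{j+1} = q
Λ(c_{j+1})` and `2^(j+1) C_{j+1} = -r c_{j+1}`, which are `ε ∂_j q` and `ε ∂_j r` by the one-point
relation of `τ`. The gauge does not change the trace of a product of two resolvents, and the
rescaling accounts for the powers of two, so `Ω^NLS` and the Toda `Ω` take the same values
(`IsTodaNLSPair.nlsEval_nlsOmega`).

The argument is algebraic and serves both settings. For functions, the algebra consists of functions
on a slice that are smooth in `t₀`, with derivation `∂/∂t₀`; evaluation at a point then gives the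
analytic statement. -/

/-! ### Derivations acting on the coefficients of a series -/

section CoeffDeriv

variable {R A : Type*} [CommRing R] [CommRing A] [Algebra R A]

/-- A derivation applied to each coefficient of a power series. -/
def coeffDeriv (d : Derivation R A A) : Derivation R A⟦X⟧ A⟦X⟧ :=
  Derivation.mk'
    { toFun := fun f => PowerSeries.mk fun n => d (coeff n f)
      map_add' := fun f g => by ext n; simp
      map_smul' := fun r f => by ext n; simp } fun f g => by
    ext1 n
    simp only [LinearMap.coe_mk, AddHom.coe_mk, coeff_mk, smul_eq_mul, map_add, coeff_mul, map_sum,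
      Derivation.leibniz]
    rw [Finset.sum_add_distrib, ← Finset.Nat.sum_antidiagonal_swap
      (f := fun p => coeff p.1 g * d (coeff p.2 f))]
    rfl

@[simp]
theorem coeff_coeffDeriv (d : Derivation R A A) (n : ℕ) (f : A⟦X⟧) :
    coeff n (coeffDeriv d f) = d (coeff n f) := by
  simp [coeffDeriv]

theorem coeffDeriv_C (d : Derivation R A A) (a : A) : coeffDeriv d (C a) = C (d a) := by
  ext n
  rw [coeff_coeffDeriv, coeff_C, coeff_C]
  split_ifs <;> simp

theorem coeffDeriv_X (d : Derivation R A A) : coeffDeriv d (X : A⟦X⟧) = 0 := by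
  ext n
  rw [coeff_coeffDeriv, coeff_X]
  split_ifs <;> simp

theorem X_pow_dvd_coeffDeriv (d : Derivation R A A) {n : ℕ} {f : A⟦X⟧} (h : (X : A⟦X⟧) ^ n ∣ f) :
    (X : A⟦X⟧) ^ n ∣ coeffDeriv d f := by
  rw [X_pow_dvd_iff] at h ⊢
  intro m hm
  simp [h m hm]

theorem eq_of_forall_X_pow_dvd_sub {f g : A⟦X⟧} (h : ∀ n : ℕ, (X : A⟦X⟧) ^ n ∣ f - g) : f = g := by
  ext1 n
  have := X_pow_dvd_iff.1 (h (n + 1)) n (Nat.lt_succ_self n)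
  rwa [map_sub, sub_eq_zero] at this

end CoeffDeriv

/-! ### The first flow of the Toda lattice hierarchy on the resolvent -/

/-! ### Scalar relations between the entries of the Toda resolvent. -/

/-- The series `α` with `R₁₁ = 1 + α`, `R₂₂ = -α`. -/
def todaAlpha : TodaPoly⟦X⟧ := todaResolvent 0 0 - 1

/-- The lower left entry of the resolvent. -/
def todaGamma : TodaPoly⟦X⟧ := todaResolvent 1 0

/-- The shift of the coefficients of a series. -/
abbrev seriesShift (m : ℤ) : TodaPoly⟦X⟧ →+* TodaPoly⟦X⟧ := PowerSeries.map (todaShift m)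

/-- The variable `v_k`. -/
abbrev varV (k : ℤ) : TodaPoly := MvPolynomial.X (TodaVar.v k)

/-- The variable `w_k`. -/
abbrev varW (k : ℤ) : TodaPoly := MvPolynomial.X (TodaVar.w k)

theorem todaResolvent_eq : todaResolvent =
    !![1 + todaAlpha, todaResolvent 0 1; todaGamma, -todaAlpha] := by
  have := isTodaResolvent_todaResolvent.trace
  rw [Matrix.trace_fin_two] at this
  refine Matrix.ext fun i j => ?_
  fin_cases i <;> fin_cases j <;> simp [todaAlpha, todaGamma]
  linear_combination this

theorem isTodaResolvent_entries :
    IsTodaResolvent !![1 + todaAlpha, todaResolvent 0 1; todaGamma, -todaAlpha] :=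
  todaResolvent_eq ▸ isTodaResolvent_todaResolvent

theorem X_dvd_todaAlpha : X ∣ todaAlpha := ((isTodaResolvent_iff _ _ _).1 isTodaResolvent_entries).1.1

theorem X_dvd_todaGamma : X ∣ todaGamma :=
  ((isTodaResolvent_iff _ _ _).1 isTodaResolvent_entries).1.2.2

theorem todaResolvent_zero_one :
    todaResolvent 0 1 = -(C (varW 0) * seriesShift 1 todaGamma) :=
  ((isTodaResolvent_iff _ _ _).1 isTodaResolvent_entries).2.1

theorem seriesShift_todaGamma : seriesShift 1 todaGamma =
    X * (C (varV 0) * seriesShift 1 todaGamma + 1 + todaAlpha + seriesShift 1 todaAlpha) :=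
  ((isTodaResolvent_iff _ _ _).1 isTodaResolvent_entries).2.2.1

theorem seriesShift_seriesShift (m n : ℤ) (f : TodaPoly⟦X⟧) :
    seriesShift m (seriesShift n f) = seriesShift (n + m) f := by
  ext1 k
  simp [todaShift_todaShift]

theorem seriesShift_zero (f : TodaPoly⟦X⟧) : seriesShift 0 f = f := by
  ext1 k
  simp [todaShift_zero]

/-- The shift by `-1` of `seriesShift_todaGamma`. Both forms are needed: the first describes `q Λγ`
and involves `v_0`, this one describes `r γ` and involves `v_{-1}`. -/
theorem todaGamma_eq : todaGamma =
    X * (C (varV (-1)) * todaGamma + 1 + seriesShift (-1) todaAlpha + todaAlpha) := by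
  have := congrArg (seriesShift (-1)) seriesShift_todaGamma
  simpa only [map_mul, map_add, map_one, seriesShift_seriesShift, PowerSeries.map_X,
    PowerSeries.map_C, todaShift_v, add_neg_cancel, zero_add, seriesShift_zero] using this

theorem todaAlpha_sq :
    todaAlpha ^ 2 + todaAlpha = C (varW 0) * (todaGamma * seriesShift 1 todaGamma) := by
  have := ((isTodaResolvent_iff _ _ _).1 isTodaResolvent_entries).2.2.2.2
  rw [todaResolvent_zero_one] at this
  linear_combination this

theorem seriesShift_todaAlpha_sub :
    (1 - X * C (varV 0)) * (seriesShift 1 todaAlpha - todaAlpha) =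
      X * (C (varW 1) * seriesShift 2 todaGamma - C (varW 0) * todaGamma) := by
  have := ((isTodaResolvent_iff _ _ _).1 isTodaResolvent_entries).2.2.2.1
  rw [todaResolvent_zero_one] at this
  change _ = X * (_ - seriesShift 1 _) at this
  rw [map_neg, map_mul, seriesShift_seriesShift, PowerSeries.map_C, todaShift_w] at this
  norm_num at this
  linear_combination this

/-! ### The vector field of the first Toda flow and its action on the resolvent. -/

/-- The vector field `ε ∂/∂t₀`: `v_k ↦ w_{k+1} - w_k`, `w_k ↦ w_k (v_k - v_{k-1})`. -/
def todaFlow : Derivation ℤ TodaPoly TodaPoly :=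
  MvPolynomial.mkDerivation ℤ fun
    | TodaVar.v k => varW (k + 1) - varW k
    | TodaVar.w k => varW k * (varV k - varV (k - 1))

theorem todaFlow_v (k : ℤ) : todaFlow (varV k) = varW (k + 1) - varW k :=
  MvPolynomial.mkDerivation_X ..

theorem todaFlow_w (k : ℤ) : todaFlow (varW k) = varW k * (varV k - varV (k - 1)) :=
  MvPolynomial.mkDerivation_X ..

theorem todaFlow_todaShift (m : ℤ) (p : TodaPoly) :
    todaFlow (todaShift m p) = todaShift m (todaFlow p) := by
  induction p using MvPolynomial.induction_on with
  | C a => simp [todaShift]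
  | add p q hp hq => simp [hp, hq]
  | mul_X p k hp =>
    rw [map_mul, Derivation.leibniz, Derivation.leibniz, map_add, smul_eq_mul, smul_eq_mul,
      smul_eq_mul, smul_eq_mul, map_mul, map_mul, hp]
    congr 2
    cases k with
    | v k => rw [todaShift_v, todaFlow_v, todaFlow_v, map_sub, todaShift_w, todaShift_w]; ring_nf
    | w k =>
      rw [todaShift_w, todaFlow_w, todaFlow_w, map_mul, map_sub, todaShift_w, todaShift_v,
        todaShift_v]
      ring_nf

theorem coeffDeriv_seriesShift (m : ℤ) (f : TodaPoly⟦X⟧) :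
    coeffDeriv todaFlow (seriesShift m f) = seriesShift m (coeffDeriv todaFlow f) := by
  ext1 n
  simp [todaFlow_todaShift]

/-- The linearization of the equations for `α`, `γ` has only the trivial solution. -/
theorem eq_zero_of_linearized {f g : TodaPoly⟦X⟧}
    (h1 : seriesShift 1 g = X * (C (varV 0) * seriesShift 1 g + f + seriesShift 1 f))
    (h2 : 2 * todaAlpha * f + f =
      C (varW 0) * (g * seriesShift 1 todaGamma + todaGamma * seriesShift 1 g)) :
    f = 0 ∧ g = 0 := by
  have kc : X ∣ seriesShift 1 todaGamma := by
    rw [seriesShift_todaGamma]; exact dvd_mul_right _ _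
  have main : ∀ n : ℕ, (X : TodaPoly⟦X⟧) ^ n ∣ f ∧ (X : TodaPoly⟦X⟧) ^ n ∣ g := by
    intro n
    induction n with
    | zero => simp
    | succ n ih =>
      obtain ⟨ia, ic⟩ := ih
      have ja := X_pow_dvd_map_todaShift (m := 1).2 ia
      have jc := X_pow_dvd_map_todaShift (m := 1).2 ic
      refine ⟨?_, ?_⟩
      · rw [pow_succ']
        have : f = C (varW 0) * (seriesShift 1 todaGamma * g + todaGamma * seriesShift 1 g) -
            todaAlpha * f * 2 := by linear_combination h2
        rw [this]
        exact dvd_sub (Dvd.dvd.mul_left (dvd_add (mul_dvd_mul kc ic)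
          (mul_dvd_mul X_dvd_todaGamma jc)) _) ((mul_dvd_mul X_dvd_todaAlpha ia).mul_right _)
      · rw [← X_pow_dvd_map_todaShift (m := 1), pow_succ']
        change _ ∣ seriesShift 1 g
        rw [h1]
        exact mul_dvd_mul_left _ (dvd_add (dvd_add (Dvd.dvd.mul_left jc _) ia) ja)
  exact ⟨eq_of_forall_X_pow_dvd_sub fun n => by simpa using (main n).1,
    eq_of_forall_X_pow_dvd_sub fun n => by simpa using (main n).2⟩

/-- The equations that determine `α` and `γ` are differentiated along the flow. The true derivatives
and the claimed ones satisfy the same inhomogeneous linear system, so their difference solves the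
homogeneous one and vanishes by `eq_zero_of_linearized`. -/
theorem todaFlow_resolvent :
    coeffDeriv todaFlow todaAlpha = C (varW 0) * (seriesShift 1 todaGamma - todaGamma) ∧
      coeffDeriv todaFlow todaGamma = todaAlpha - seriesShift (-1) todaAlpha := by
  have d1 := congrArg (coeffDeriv todaFlow) seriesShift_todaGamma
  have d2 := congrArg (coeffDeriv todaFlow) todaAlpha_sq
  simp only [Derivation.leibniz, map_add, Derivation.leibniz_pow, coeffDeriv_C, coeffDeriv_X,
    coeffDeriv_seriesShift, smul_eq_mul, todaFlow_v, todaFlow_w, Derivation.map_one_eq_zero,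
    zero_add, zero_sub, map_sub, map_mul] at d1 d2
  have s1 : seriesShift 1 (C (varW 0)) = C (varW 1) := by
    rw [PowerSeries.map_C, todaShift_w, zero_add]
  have key := eq_zero_of_linearized
    (f := coeffDeriv todaFlow todaAlpha - C (varW 0) * (seriesShift 1 todaGamma - todaGamma))
    (g := coeffDeriv todaFlow todaGamma - (todaAlpha - seriesShift (-1) todaAlpha)) ?_ ?_
  · exact ⟨sub_eq_zero.1 key.1, sub_eq_zero.1 key.2⟩
  · simp only [map_sub, map_mul, s1, seriesShift_seriesShift, neg_add_cancel, seriesShift_zero]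
    norm_num
    linear_combination d1 - seriesShift_todaAlpha_sub
  · simp only [map_sub, seriesShift_seriesShift, neg_add_cancel, seriesShift_zero]
    -- The terms `v_0 Λγ` and `v_{-1} γ` coming from the derivative of `w_0` can be eliminated only
    -- with a factor `X` in front, by the two recursions for `γ`.
    apply mul_left_cancel₀ (X_ne_zero (R := TodaPoly))
    simp only [nsmul_eq_mul, Nat.cast_ofNat, pow_one, Nat.add_one_sub_one] at d2
    linear_combination X * d2 - C (varW 0) * todaGamma * seriesShift_todaGamma +
      C (varW 0) * seriesShift 1 todaGamma * todaGamma_eq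

/-- The determinant relation `α = w γ Λγ - α²` is quadratic in series divisible by `X`, which gives
the factor `X ^ 2`. It then makes `α²` divisible by `X ^ 4`, so the leading coefficient of `α` comes
from `w γ Λγ` alone. -/
theorem exists_todaAlpha_eq_X_sq_mul : ∃ f g : TodaPoly⟦X⟧, todaAlpha = X ^ 2 * f ∧
    todaGamma = X * g ∧ constantCoeff f = varW 0 ∧ constantCoeff g = 1 := by
  obtain ⟨a, ha⟩ := X_dvd_todaAlpha
  set g := C (varV (-1)) * todaGamma + 1 + seriesShift (-1) todaAlpha + todaAlpha with hg
  have hγ : todaGamma = X * g := todaGamma_eq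
  have hg1 : constantCoeff g = 1 := by
    rw [hg, hγ, ha]
    simp [PowerSeries.map_X]
  have h := todaAlpha_sq
  have hα : todaAlpha = X ^ 2 * (C (varW 0) * (g * seriesShift 1 g) - a ^ 2) := by
    rw [hγ] at h
    simp only [map_mul, PowerSeries.map_X] at h
    linear_combination h - (todaAlpha + X * a) * ha
  have ha0 : constantCoeff a = 0 := by
    rw [ha, pow_two X, mul_assoc] at hα
    rw [mul_left_cancel₀ X_ne_zero hα]
    simp
  have hg2 : constantCoeff (seriesShift 1 g) = 1 := by
    rw [← coeff_zero_eq_constantCoeff_apply, coeff_map, coeff_zero_eq_constantCoeff_apply, hg1,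
      map_one]
  exact ⟨_, g, hα, hγ, by simp [hg1, ha0, hg2], hg1⟩

/-- With `todaC_one`, this identifies the flow `j = 0` of the hierarchy with `todaFlow`. -/
theorem todaA_one : todaA 1 = varW 0 := by
  obtain ⟨f, g, hf, -, h, -⟩ := exists_todaAlpha_eq_X_sq_mul
  have : todaResolvent 0 0 = 1 + todaAlpha := by rw [todaAlpha]; ring
  rw [todaA, this, hf, map_add, coeff_X_pow_mul', coeff_one]
  simpa using h

theorem todaC_one : todaC 1 = varV (-1) := by
  obtain ⟨f, g, hf, hg, -, h⟩ := exists_todaAlpha_eq_X_sq_mul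
  change coeff (1 + 1) todaGamma = _
  rw [todaGamma_eq, coeff_succ_X_mul, hf, hg]
  simp only [map_mul, map_add, map_pow, PowerSeries.map_X, coeff_C_mul, coeff_X_pow_mul', coeff_one]
  rw [show (1 : ℕ) = 0 + 1 from rfl, coeff_succ_X_mul]
  simp [h]

/-! ### Functoriality and uniqueness of two-point series -/

section TwoPoint

variable {P Q : Type*} [CommRing P] [CommRing Q]

/-- The outer coefficients satisfy `X * F₀ = 0` and `X * F_{n+1} = F_n`, and the inner variable is
never a zero divisor. No integrality of `P` enters, so two-point families remain unique after
evaluation in an arbitrary algebra. -/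
theorem eq_zero_of_X_sub_C_X_mul {F : P⟦X⟧⟦X⟧} (h : ((X : P⟦X⟧⟦X⟧) - C (X : P⟦X⟧)) * F = 0) :
    F = 0 := by
  have X_reg : ∀ f : P⟦X⟧, X * f = 0 → f = 0 := fun f hf => by
    ext n
    simpa [coeff_succ_X_mul] using congrArg (coeff (n + 1)) hf
  rw [sub_mul, sub_eq_zero] at h
  ext1 n
  induction n with
  | zero =>
    refine X_reg _ ?_
    rw [← coeff_C_mul, ← h, coeff_zero_X_mul]
  | succ n ih =>
    refine X_reg _ ?_
    rw [← coeff_C_mul, ← h, coeff_succ_X_mul, ih, map_zero]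

theorem IsTwoPoint.unique {M : Matrix (Fin 2) (Fin 2) P⟦X⟧} {c : P} {Ω Ω' : ℕ → ℕ → P}
    (h : IsTwoPoint M c Ω) (h' : IsTwoPoint M c Ω') : Ω = Ω' := by
  rw [IsTwoPoint] at h h'
  have e := sub_eq_zero.2 (h.trans h'.symm)
  rw [← mul_sub, pow_two, mul_assoc] at e
  have e' := sub_eq_zero.1 (eq_zero_of_X_sub_C_X_mul (eq_zero_of_X_sub_C_X_mul e))
  funext i j
  simpa using congrArg (fun F => coeff j (coeff i F)) e'

/-- The two-point identity in terms of the entries. -/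
theorem isTwoPoint_iff {M : Matrix (Fin 2) (Fin 2) P⟦X⟧} {c : P} {Ω : ℕ → ℕ → P} :
    IsTwoPoint M c Ω ↔ ((X : P⟦X⟧⟦X⟧) - C (X : P⟦X⟧)) ^ 2 *
        PowerSeries.mk (fun i => PowerSeries.mk (fun j => Ω i j)) =
      PowerSeries.map C (M 0 0) * C (M 0 0) + PowerSeries.map C (M 0 1) * C (M 1 0) +
        (PowerSeries.map C (M 1 0) * C (M 0 1) + PowerSeries.map C (M 1 1) * C (M 1 1)) -
        C (C c) := by
  simp [IsTwoPoint, Matrix.trace_fin_two, Matrix.mul_apply, Fin.sum_univ_two]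

theorem map_map_C (φ : P →+* Q) (f : P⟦X⟧) :
    PowerSeries.map (PowerSeries.map φ) (PowerSeries.map C f) =
      PowerSeries.map C (PowerSeries.map φ f) := by
  ext i j
  simp [coeff_C]

theorem IsTwoPoint.map {M : Matrix (Fin 2) (Fin 2) P⟦X⟧} {c : P} {Ω : ℕ → ℕ → P}
    (h : IsTwoPoint M c Ω) (φ : P →+* Q) :
    IsTwoPoint (M.map (PowerSeries.map φ)) (φ c) fun i j => φ (Ω i j) := by
  rw [isTwoPoint_iff] at h ⊢
  have e := congrArg (PowerSeries.map (PowerSeries.map φ)) h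
  simp only [map_mul, map_add, map_sub, map_pow, PowerSeries.map_X, PowerSeries.map_C,
    map_map_C] at e
  simp only [Matrix.map_apply]
  rw [← e]
  congr 1

/-- The outer `rescale (C s)` scales `ξ⁻¹` and `map (rescale s)` scales `ν⁻¹`; a series in the outer
variable alone feels only the former. -/
theorem rescale_C_map_C (s : P) (f : P⟦X⟧) :
    rescale (C s) (PowerSeries.map (rescale s) (PowerSeries.map C f)) =
      PowerSeries.map C (rescale s f) := by
  ext i j
  simp only [coeff_rescale, coeff_map, ← map_pow, coeff_C_mul, coeff_C]
  split_ifs with h <;> simp [h]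

theorem rescale_C_eq (s a : P) : rescale s (C a) = C a := by
  ext n
  rw [coeff_rescale, coeff_C]
  split_ifs with h <;> simp [h]

/-- Rescaling both spectral parameters by a factor two and conjugating by a diagonal matrix. -/
theorem IsTwoPoint.rescale {M : Matrix (Fin 2) (Fin 2) P⟦X⟧} {c s : P} {Ω : ℕ → ℕ → P}
    (H : IsTwoPoint M c Ω) (hs : 2 * s = 1) {b' c' : P⟦X⟧}
    -- The trace sees the off-diagonal entries only through these products. Prescribing them
    -- replaces conjugation by a diagonal matrix, so the gauge factor need not be invertible.
    (hgh : ∀ i j, coeff i b' * coeff j c' =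
      4 * (coeff i (PowerSeries.rescale s (M 0 1)) * coeff j (PowerSeries.rescale s (M 1 0)))) :
    IsTwoPoint !![2 * PowerSeries.rescale s (M 0 0), b'; c', 2 * PowerSeries.rescale s (M 1 1)]
      (4 * c) fun i j => s ^ (i + j) * Ω i j := by
  have four : (4 : P⟦X⟧⟦X⟧) = C (C (4 : P)) := by
    rw [map_ofNat (C (R := P)), map_ofNat (C (R := P⟦X⟧))]
  have e1 : PowerSeries.map C b' * C c' = 4 * (PowerSeries.map C (PowerSeries.rescale s (M 0 1)) *
      C (PowerSeries.rescale s (M 1 0))) := by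
    ext i j
    rw [four, coeff_C_mul, coeff_C_mul, coeff_mul_C, coeff_mul_C, coeff_map, coeff_map, coeff_C_mul,
      coeff_C_mul, hgh]
  have e2 : PowerSeries.map C c' * C b' = 4 * (PowerSeries.map C (PowerSeries.rescale s (M 1 0)) *
      C (PowerSeries.rescale s (M 0 1))) := by
    ext i j
    rw [four, coeff_C_mul, coeff_C_mul, coeff_mul_C, coeff_mul_C, coeff_map, coeff_map, coeff_C_mul,
      coeff_C_mul, mul_comm, hgh, mul_comm (coeff j _)]
  rw [isTwoPoint_iff] at H ⊢
  have e := congrArg (PowerSeries.rescale (C s)) (congrArg (PowerSeries.map (PowerSeries.rescale s)) H)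
  simp only [map_mul, map_add, map_sub, map_pow, PowerSeries.map_X, PowerSeries.map_C,
    rescale_C_map_C, rescale_C_eq, rescale_X] at e
  have hmk : PowerSeries.mk (fun i => PowerSeries.mk (fun j => s ^ (i + j) * Ω i j)) =
      PowerSeries.rescale (C s) (PowerSeries.map (PowerSeries.rescale s)
        (PowerSeries.mk (fun i => PowerSeries.mk (fun j => Ω i j)))) := by
    ext i j
    simp only [coeff_mk, coeff_rescale, coeff_map, ← map_pow, coeff_C_mul]
    ring
  -- The prefactor `(X - C X) ^ 2` picks up `s ^ 2` under the rescaling, and doubling both matrices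
  -- contributes `4`; with `s = 1/2` the two cancel.
  have h4 : (4 : P⟦X⟧⟦X⟧) * C (C s) ^ 2 = 1 := by
    rw [four, ← map_pow, ← map_pow, ← map_mul, ← map_mul,
      show 4 * s ^ 2 = 1 by linear_combination (2 * s + 1) * hs, map_one, map_one]
  rw [hmk]
  simp only [Matrix.of_apply, Matrix.cons_val', Matrix.cons_val_zero, Matrix.cons_val_one,
    Matrix.cons_val_fin_one, map_mul, map_ofNat, e1, e2]
  linear_combination 4 * e - ((X : P⟦X⟧⟦X⟧) - C X) ^ 2 * PowerSeries.rescale (C s)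
    (PowerSeries.map (PowerSeries.rescale s)
      (PowerSeries.mk (fun i => PowerSeries.mk (fun j => Ω i j)))) * h4

end TwoPoint

/-! ### Evaluation of the resolvents -/

section Evaluation

variable {A : Type*} [CommRing A] [Algebra ℂ A]

/-- The equations of the basic resolvent of the AKNS operator determine its entries. -/
theorem eq_of_akns_unique (D : Derivation ℂ A A) {ε q r a b c a' b' c' : A⟦X⟧}
    (ha : X ∣ a) (hb : X ∣ b) (ha' : X ∣ a') (hc' : X ∣ c')
    (h1 : 2 * b = X * (ε * coeffDeriv D b + 2 * q * (1 + a)))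
    (h2 : 2 * c = -(X * (ε * coeffDeriv D c + 2 * r * (1 + a))))
    (h3 : a ^ 2 + 2 * a + b * c = 0)
    (h1' : 2 * b' = X * (ε * coeffDeriv D b' + 2 * q * (1 + a')))
    (h2' : 2 * c' = -(X * (ε * coeffDeriv D c' + 2 * r * (1 + a'))))
    (h3' : a' ^ 2 + 2 * a' + b' * c' = 0) : a = a' ∧ b = b' ∧ c = c' := by
  have two : IsUnit (2 : A⟦X⟧) := by
    have := (isUnit_of_invertible (2 : ℂ)).map (algebraMap ℂ A⟦X⟧)
    rwa [map_ofNat] at this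
  have main : ∀ n : ℕ, (X : A⟦X⟧) ^ n ∣ a - a' ∧ (X : A⟦X⟧) ^ n ∣ b - b' ∧
      (X : A⟦X⟧) ^ n ∣ c - c' := by
    intro n
    induction n with
    | zero => simp
    | succ n ih =>
      obtain ⟨ia, ib, ic⟩ := ih
      refine ⟨?_, ?_, ?_⟩
      · rw [← two.dvd_mul_left, pow_succ']
        have : 2 * (a - a') = -((a + a') * (a - a') + b * (c - c') + c' * (b - b')) := by
          linear_combination h3 - h3'
        rw [this]
        exact (dvd_add (dvd_add (mul_dvd_mul (dvd_add ha ha') ia) (mul_dvd_mul hb ic))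
          (mul_dvd_mul hc' ib)).neg_right
      · rw [← two.dvd_mul_left, pow_succ']
        have : 2 * (b - b') = X * (ε * coeffDeriv D (b - b') + 2 * q * (a - a')) := by
          rw [map_sub]; linear_combination h1 - h1'
        rw [this]
        exact mul_dvd_mul_left _ (dvd_add (Dvd.dvd.mul_left (X_pow_dvd_coeffDeriv D ib) _)
          (Dvd.dvd.mul_left ia _))
      · rw [← two.dvd_mul_left, pow_succ']
        have : 2 * (c - c') = X * -(ε * coeffDeriv D (c - c') + 2 * r * (a - a')) := by
          rw [map_sub]; linear_combination h2 - h2'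
        rw [this]
        exact mul_dvd_mul_left _ (dvd_add (Dvd.dvd.mul_left (X_pow_dvd_coeffDeriv D ic) _)
          (Dvd.dvd.mul_left ia _)).neg_right
  exact ⟨eq_of_forall_X_pow_dvd_sub fun n => (main n).1,
    eq_of_forall_X_pow_dvd_sub fun n => (main n).2.1,
    eq_of_forall_X_pow_dvd_sub fun n => (main n).2.2⟩

theorem nlsEval_nlsEps (ε : A) (q r : ℕ → A) : nlsEval ε q r nlsEps = ε := by
  simp [nlsEval, nlsEps]

theorem nlsEval_q (ε : A) (q r : ℕ → A) (i : ℕ) :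
    nlsEval ε q r (MvPolynomial.X (NLSVar.q i)) = q i := by
  simp [nlsEval]

theorem nlsEval_r (ε : A) (q r : ℕ → A) (i : ℕ) :
    nlsEval ε q r (MvPolynomial.X (NLSVar.r i)) = r i := by
  simp [nlsEval]

theorem map_nlsEval {B : Type*} [CommRing B] [Algebra ℂ B] (f : A →ₐ[ℂ] B) (ε : A) (q r : ℕ → A)
    (p : NLSPoly) :
    f (nlsEval ε q r p) = nlsEval (f ε) (fun i => f (q i)) (fun i => f (r i)) p := by
  suffices (f : A →+* B).comp (nlsEval ε q r) =
      nlsEval (f ε) (fun i => f (q i)) (fun i => f (r i)) from RingHom.congr_fun this p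
  refine MvPolynomial.ringHom_ext (fun c => ?_) fun k => ?_
  · simp [nlsEval, Polynomial.aeval_algHom_apply]
  · cases k <;> simp [nlsEval]

theorem todaEval_v {A : Type*} [CommRing A] (v w : ℤ → A) (k : ℤ) : todaEval v w (varV k) = v k := by
  simp [todaEval]

theorem todaEval_w {A : Type*} [CommRing A] (v w : ℤ → A) (k : ℤ) : todaEval v w (varW k) = w k := by
  simp [todaEval]

theorem map_todaEval {A B : Type*} [CommRing A] [CommRing B] (f : A →+* B) (v w : ℤ → A)
    (p : TodaPoly) : f (todaEval v w p) = todaEval (fun k => f (v k)) (fun k => f (w k)) p := by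
  suffices f.comp (todaEval v w) = todaEval (fun k => f (v k)) (fun k => f (w k)) from
    RingHom.congr_fun this p
  refine MvPolynomial.ringHom_ext (fun c => ?_) fun k => ?_
  · simp [todaEval]
  · cases k <;> simp [todaEval]

theorem todaEval_todaShift {A : Type*} [CommRing A] (v w : ℤ → A) (m : ℤ) (p : TodaPoly) :
    todaEval v w (todaShift m p) = todaEval (fun k => v (k + m)) (fun k => w (k + m)) p := by
  suffices (todaEval v w).comp (todaShift m) =
      todaEval (fun k => v (k + m)) (fun k => w (k + m)) from RingHom.congr_fun this p
  refine MvPolynomial.ringHom_ext (fun c => ?_) fun k => ?_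
  · simp [todaEval, todaShift]
  · cases k <;> simp [todaEval, todaShift]

/-- Evaluating at the jets `D^[i] q`, `D^[i] r` intertwines the formal `∂` with `D`, so the
resolvent equations survive evaluation. -/
theorem nlsEval_nlsD (D : Derivation ℂ A A) {ε : A} (hε : D ε = 0) (q r : A) (p : NLSPoly) :
    nlsEval ε (fun i => D^[i] q) (fun i => D^[i] r) (nlsD p) =
      D (nlsEval ε (fun i => D^[i] q) (fun i => D^[i] r) p) := by
  induction p using MvPolynomial.induction_on with
  | C a =>
    have : D (Polynomial.aeval ε a) = 0 := by
      rw [Derivation.map_aeval, hε, smul_zero]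
    simp [nlsEval, nlsD, this]
  | add p q hp hq => simp [hp, hq]
  | mul_X p k hp =>
    rw [Derivation.leibniz, map_mul, Derivation.leibniz, map_add, smul_eq_mul, smul_eq_mul,
      smul_eq_mul, smul_eq_mul, map_mul, map_mul, hp]
    congr 2
    cases k <;> simp [nlsEval, nlsD, MvPolynomial.mkDerivation_X, Function.iterate_succ_apply']

theorem todaEval_todaFlow (D : Derivation ℂ A A) {ε : A} {v w : ℤ → A}
    (hv : ∀ k, ε * D (v k) = w (k + 1) - w k) (hw : ∀ k, ε * D (w k) = w k * (v k - v (k - 1)))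
    (p : TodaPoly) : todaEval v w (todaFlow p) = ε * D (todaEval v w p) := by
  induction p using MvPolynomial.induction_on with
  | C a => simp [todaEval]
  | add p q hp hq => simp [hp, hq, mul_add]
  | mul_X p k hp =>
    rw [Derivation.leibniz, map_mul, Derivation.leibniz, map_add, smul_eq_mul, smul_eq_mul,
      smul_eq_mul, smul_eq_mul, map_mul, map_mul, hp]
    have : todaEval v w (todaFlow (MvPolynomial.X k)) =
        ε * D (todaEval v w (MvPolynomial.X k)) := by
      cases k with
      | v k => rw [todaFlow_v, map_sub, todaEval_w, todaEval_w, todaEval_v, hv]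
      | w k =>
        rw [todaFlow_w, map_mul, map_sub, todaEval_w, todaEval_v, todaEval_v, hw]
    rw [this]
    ring

theorem nlsResolvent_equations : ∃ a b c : NLSPoly⟦X⟧, nlsResolvent = !![2 + a, b; c, -a] ∧
    (X ∣ a ∧ X ∣ b ∧ X ∣ c) ∧
    2 * b = X * (C nlsEps * nlsDSeries b + 2 * C (MvPolynomial.X (NLSVar.q 0)) * (1 + a)) ∧
    2 * c = -(X * (C nlsEps * nlsDSeries c + 2 * C (MvPolynomial.X (NLSVar.r 0)) * (1 + a))) ∧
    a ^ 2 + 2 * a + b * c = 0 := by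
  have form : nlsResolvent = !![2 + (nlsResolvent 0 0 - 2), nlsResolvent 0 1;
      nlsResolvent 1 0, -(nlsResolvent 0 0 - 2)] := by
    have := isNLSResolvent_nlsResolvent.trace
    rw [Matrix.trace_fin_two] at this
    refine Matrix.ext fun i j => ?_
    fin_cases i <;> fin_cases j <;> simp
    linear_combination this
  have h := isNLSResolvent_nlsResolvent
  rw [form] at h
  obtain ⟨h1, -, h2⟩ := (isNLSResolvent_iff _ _ _).1 h
  exact ⟨_, _, _, form, h1, h2⟩

theorem coeffDeriv_rescale (D : Derivation ℂ A A) (s : ℂ) (f : A⟦X⟧) :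
    coeffDeriv D (rescale (algebraMap ℂ A s) f) = rescale (algebraMap ℂ A s) (coeffDeriv D f) := by
  ext n
  rw [coeff_coeffDeriv, coeff_rescale, coeff_rescale, coeff_coeffDeriv, ← map_pow,
    ← Algebra.smul_def, ← Algebra.smul_def, D.map_smul]

end Evaluation

/-! ### The gauge equivalence of the Toda and AKNS resolvents -/

section Gauge

variable {A : Type*} [CommRing A] [Algebra ℂ A]

/-- The value of a series over `ℤ[𝐯, 𝐰]` as a function of `ξ⁻¹`, where `λ = 2 ξ`. -/
def gaugeEval (v w : ℤ → A) : TodaPoly⟦X⟧ →+* A⟦X⟧ :=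
  (rescale (algebraMap ℂ A (1 / 2))).comp (PowerSeries.map (todaEval v w))

theorem coeff_gaugeEval (v w : ℤ → A) (n : ℕ) (f : TodaPoly⟦X⟧) :
    coeff n (gaugeEval v w f) = algebraMap ℂ A (1 / 2) ^ n * todaEval v w (coeff n f) := by
  simp [gaugeEval, coeff_rescale]

theorem gaugeEval_C (v w : ℤ → A) (p : TodaPoly) :
    gaugeEval v w (C p) = C (todaEval v w p) := by
  simp [gaugeEval, rescale_C_eq]

theorem gaugeEval_X (v w : ℤ → A) :
    gaugeEval v w X = C (algebraMap ℂ A (1 / 2)) * X := by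
  simp [gaugeEval, rescale_X]

theorem X_dvd_gaugeEval (v w : ℤ → A) {f : TodaPoly⟦X⟧} (h : X ∣ f) : X ∣ gaugeEval v w f := by
  obtain ⟨g, rfl⟩ := h
  rw [map_mul, gaugeEval_X]
  exact Dvd.dvd.mul_right (dvd_mul_left _ _) _

theorem two_mul_algebraMap_half : 2 * algebraMap ℂ A (1 / 2) = 1 := by
  rw [← map_ofNat (algebraMap ℂ A) 2, ← map_mul]
  norm_num

/-- `ε D` extends the first flow of the Toda lattice, `(q, r)` are the dependent variables of the
NLS equation that correspond to `(v, w)`. -/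
structure IsTodaNLSPair (D : Derivation ℂ A A) (ε : A) (v w : ℤ → A) (q r : A) : Prop where
  d_eps : D ε = 0
  d_v : ∀ k, ε * D (v k) = w (k + 1) - w k
  d_w : ∀ k, ε * D (w k) = w k * (v k - v (k - 1))
  d_q : ε * D q = v 0 * q
  d_r : ε * D r = -(v (-1) * r)
  q_mul_r : q * r = w 0

namespace IsTodaNLSPair

variable {D : Derivation ℂ A A} {ε : A} {v w : ℤ → A} {q r : A}

theorem coeffDeriv_gaugeEval (h : IsTodaNLSPair D ε v w q r) (f : TodaPoly⟦X⟧) :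
    C ε * coeffDeriv D (gaugeEval v w f) = gaugeEval v w (coeffDeriv todaFlow f) := by
  ext n
  simp only [gaugeEval, RingHom.comp_apply, coeffDeriv_rescale, coeff_C_mul, coeff_rescale,
    coeff_map, coeff_coeffDeriv, todaEval_todaFlow D h.d_v h.d_w]
  ring

/-- Both sides solve the equations of `eq_of_akns_unique`: the left one as the value of the
universal resolvent, the right one by the first Toda flow on `γ` and the equations for `q` and `r`.
-/
theorem map_nlsResolvent (h : IsTodaNLSPair D ε v w q r) :
    nlsResolvent.map
        (PowerSeries.map (nlsEval ε (fun i => D^[i] q) (fun i => D^[i] r))) =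
      !![2 * gaugeEval v w (todaResolvent 0 0), 2 * (C q * gaugeEval v w (seriesShift 1 todaGamma));
        -(2 * (C r * gaugeEval v w todaGamma)), 2 * gaugeEval v w (todaResolvent 1 1)] := by
  obtain ⟨a, b, c, hR, ⟨ha, hb, hc⟩, h1, h2, h3⟩ := nlsResolvent_equations
  set φ := nlsEval ε (fun i => D^[i] q) (fun i => D^[i] r) with hφ
  have hD : ∀ f, PowerSeries.map φ (nlsDSeries f) = coeffDeriv D (PowerSeries.map φ f) := by
    intro f
    ext n
    simp [nlsDSeries, hφ, nlsEval_nlsD D h.d_eps]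
  have hX : ∀ f : NLSPoly⟦X⟧, X ∣ f → X ∣ PowerSeries.map φ f := by
    rintro _ ⟨g, rfl⟩
    rw [map_mul, PowerSeries.map_X]
    exact dvd_mul_right _ _
  have e1 := congrArg (PowerSeries.map φ) h1
  have e2 := congrArg (PowerSeries.map φ) h2
  have e3 := congrArg (PowerSeries.map φ) h3
  simp only [map_mul, map_add, map_neg, map_pow, map_one, map_zero, map_ofNat, PowerSeries.map_X,
    PowerSeries.map_C, hD] at e1 e2 e3
  simp only [hφ, nlsEval_q, nlsEval_r, nlsEval_nlsEps, Function.iterate_zero, id_eq] at e1 e2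
  rw [← hφ] at e1 e2
  obtain ⟨-, flowγ⟩ := todaFlow_resolvent
  set ρ := gaugeEval v w with hρ
  have half : (2 : A⟦X⟧) * C (algebraMap ℂ A (1 / 2)) = 1 := by
    rw [← map_ofNat (C (R := A)) 2, ← map_mul, two_mul_algebraMap_half, map_one]
  have dγ : C ε * coeffDeriv D (ρ todaGamma) = ρ todaAlpha - ρ (seriesShift (-1) todaAlpha) := by
    rw [h.coeffDeriv_gaugeEval, flowγ, map_sub]
  have dγ' : C ε * coeffDeriv D (ρ (seriesShift 1 todaGamma)) =
      ρ (seriesShift 1 todaAlpha) - ρ todaAlpha := by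
    rw [h.coeffDeriv_gaugeEval, coeffDeriv_seriesShift, flowγ, map_sub, map_sub,
      seriesShift_seriesShift, neg_add_cancel, seriesShift_zero]
  have g1 := congrArg ρ seriesShift_todaGamma
  have g2 := congrArg ρ todaGamma_eq
  have g3 := congrArg ρ todaAlpha_sq
  simp only [map_mul _ (_ : TodaPoly⟦X⟧), map_add, map_pow, map_one] at g1 g2 g3
  simp only [hρ, gaugeEval_X, gaugeEval_C, todaEval_v, todaEval_w] at g1 g2 g3
  rw [← hρ] at g1 g2 g3
  have cq := congrArg (C (R := A)) h.d_q
  have cr := congrArg (C (R := A)) h.d_r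
  have cw := congrArg (C (R := A)) h.q_mul_r
  simp only [map_mul, map_neg] at cq cr cw
  have d2 : coeffDeriv D (2 : A⟦X⟧) = 0 := by
    have := (coeffDeriv D).map_natCast 2
    simpa using this
  -- Here `ε ∂(q Λγ) = q (v Λγ + Λα - α)`. Adding `q (1 + 2α)` gives `q (v Λγ + 1 + α + Λα)`, the
  -- bracket in the recursion for `Λγ`. The factor `1/2` is `λ⁻¹ = ξ⁻¹ / 2`.
  have f1 : 2 * (2 * (C q * ρ (seriesShift 1 todaGamma))) =
      X * (C ε * coeffDeriv D (2 * (C q * ρ (seriesShift 1 todaGamma))) +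
        2 * C q * (1 + 2 * ρ todaAlpha)) := by
    simp only [Derivation.leibniz, coeffDeriv_C, smul_eq_mul, d2]
    linear_combination 4 * C q * g1 - 2 * X * C q * dγ' -
      2 * X * ρ (seriesShift 1 todaGamma) * cq + 2 * X * C q * (C (v 0) *
        ρ (seriesShift 1 todaGamma) + 1 + ρ todaAlpha + ρ (seriesShift 1 todaAlpha)) * half
  have f2 : 2 * -(2 * (C r * ρ todaGamma)) =
      -(X * (C ε * coeffDeriv D (-(2 * (C r * ρ todaGamma))) +
        2 * C r * (1 + 2 * ρ todaAlpha))) := by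
    simp only [Derivation.leibniz, map_neg, coeffDeriv_C, smul_eq_mul, d2]
    linear_combination -4 * C r * g2 - 2 * X * C r * dγ -
      2 * X * ρ todaGamma * cr - 2 * X * C r * (C (v (-1)) *
        ρ todaGamma + 1 + ρ todaAlpha + ρ (seriesShift (-1) todaAlpha)) * half
  -- Four times the Toda determinant relation, with `w` replaced by `q r`.
  have f3 : (2 * ρ todaAlpha) ^ 2 + 2 * (2 * ρ todaAlpha) +
      2 * (C q * ρ (seriesShift 1 todaGamma)) * -(2 * (C r * ρ todaGamma)) = 0 := by
    linear_combination 4 * g3 - 4 * ρ todaGamma * ρ (seriesShift 1 todaGamma) * cw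
  obtain ⟨ka, kb, kc⟩ := eq_of_akns_unique D (hX _ ha) (hX _ hb)
    (Dvd.dvd.mul_left (X_dvd_gaugeEval v w X_dvd_todaAlpha) _)
    (Dvd.dvd.mul_left (Dvd.dvd.mul_left (X_dvd_gaugeEval v w X_dvd_todaGamma) _) _).neg_right
    e1 e2 e3 f1 f2 f3
  rw [← hρ] at ka kc
  have z : ∀ i j, PowerSeries.map φ (nlsResolvent i j) =
      PowerSeries.map φ (!![2 + a, b; c, -a] i j) := fun i j => by rw [hR]
  have z00 : todaResolvent 0 0 = 1 + todaAlpha := by rw [todaAlpha]; ring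
  have z11 : todaResolvent 1 1 = -todaAlpha := by rw [todaResolvent_eq]; simp
  refine Matrix.ext fun i j => ?_
  rw [Matrix.map_apply, z]
  fin_cases i <;> fin_cases j
  · simp [ka, z00, mul_add, map_ofNat (PowerSeries.map φ)]
  · simp [kb]
  · simp [kc]
  · simp [ka, z11]

theorem nlsEval_nlsB (h : IsTodaNLSPair D ε v w q r) (j : ℕ) :
    2 ^ (j + 1) * nlsEval ε (fun i => D^[i] q) (fun i => D^[i] r) (nlsB (j + 1)) =
      q * todaEval v w (todaShift 1 (todaC (j + 1))) := by
  have e := congrArg (coeff (j + 2)) (congrFun (congrFun h.map_nlsResolvent 0) 1)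
  rw [Matrix.map_apply, coeff_map] at e
  change nlsEval ε _ _ (nlsB (j + 1)) = _ at e
  -- `B_{j+1}` is the coefficient of `ξ^(-j-2)`: the rescaling contributes `2^(-j-2)` and the
  -- doubled entry one factor `2`, which together cancel `2^(j+1)`.
  have half : (2 * algebraMap ℂ A (1 / 2)) ^ (j + 2) = 1 := by
    rw [two_mul_algebraMap_half, one_pow]
  rw [mul_pow] at half
  rw [e, ← map_ofNat (C (R := A)) 2]
  simp only [Matrix.of_apply, Matrix.cons_val', Matrix.cons_val_zero, Matrix.cons_val_one,
    Matrix.cons_val_fin_one, coeff_C_mul, coeff_gaugeEval, coeff_map]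
  change _ = q * todaEval v w (todaShift 1 (coeff (j + 2) todaGamma))
  linear_combination q * todaEval v w (todaShift 1 (coeff (j + 2) todaGamma)) * half

theorem nlsEval_nlsC (h : IsTodaNLSPair D ε v w q r) (j : ℕ) :
    2 ^ (j + 1) * nlsEval ε (fun i => D^[i] q) (fun i => D^[i] r) (nlsC (j + 1)) =
      -(r * todaEval v w (todaC (j + 1))) := by
  have e := congrArg (coeff (j + 2)) (congrFun (congrFun h.map_nlsResolvent 1) 0)
  rw [Matrix.map_apply, coeff_map] at e
  change nlsEval ε _ _ (nlsC (j + 1)) = _ at e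
  have half : (2 * algebraMap ℂ A (1 / 2)) ^ (j + 2) = 1 := by
    rw [two_mul_algebraMap_half, one_pow]
  rw [mul_pow] at half
  rw [e, ← map_ofNat (C (R := A)) 2]
  simp only [Matrix.of_apply, Matrix.cons_val', Matrix.cons_val_zero, Matrix.cons_val_one,
    Matrix.cons_val_fin_one, coeff_C_mul, coeff_gaugeEval, map_neg]
  change _ = -(r * todaEval v w (coeff (j + 2) todaGamma))
  linear_combination -r * todaEval v w (coeff (j + 2) todaGamma) * half

/-- Two families are two-point families of the same matrix: the evaluated NLS one, and the Toda one
transported by `IsTwoPoint.rescale`, whose condition on products holds because `q r = w`. Uniqueness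
identifies them, and the normalization `2^(i+j)` in `nlsOmega` absorbs the rescaling. -/
theorem nlsEval_nlsOmega (h : IsTodaNLSPair D ε v w q r) (i j : ℕ) :
    nlsEval ε (fun i => D^[i] q) (fun i => D^[i] r) (nlsOmega i j) =
      todaEval v w (todaOmega i j) := by
  have hN := (existsUnique_nlsTwoPoint.choose_spec.1).map
    (nlsEval ε (fun i => D^[i] q) (fun i => D^[i] r))
  have hT := ((existsUnique_todaTwoPoint.choose_spec.1).map (todaEval v w)).rescale
    (two_mul_algebraMap_half (A := A))
    (b' := 2 * (C q * gaugeEval v w (seriesShift 1 todaGamma)))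
    (c' := -(2 * (C r * gaugeEval v w todaGamma))) (fun m n => by
      rw [← map_ofNat (C (R := A)) 2, Matrix.map_apply, Matrix.map_apply, todaResolvent_zero_one]
      simp only [coeff_C_mul, coeff_gaugeEval, map_neg, coeff_rescale, coeff_map, map_mul (todaEval v w),
        todaEval_w, ← h.q_mul_r, todaGamma]
      ring)
  rw [h.map_nlsResolvent] at hN
  have hc : nlsEval ε (fun i => D^[i] q) (fun i => D^[i] r) (2 ^ 2) =
      4 * todaEval v w (1 ^ 2) := by
    rw [map_pow, map_ofNat, one_pow, map_one]
    norm_num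
  rw [hc] at hN
  have e := congrFun (congrFun (hN.unique hT) i) j
  have half : (2 * algebraMap ℂ A (1 / 2)) ^ (i + j) = 1 := by
    rw [two_mul_algebraMap_half, one_pow]
  rw [mul_pow] at half
  rw [nlsOmega, map_mul, map_pow, map_ofNat, e, ← mul_assoc, half, one_mul]
  rfl

end IsTodaNLSPair

end Gauge

/-! ### Formal solutions -/

section FormalSolutions

variable {A : Type*} [CommRing A] [Algebra ℂ A] {d : ℕ → Derivation ℂ A A} {Λ : A ≃ₐ[ℂ] A} {ε : Aˣ}

theorem IsLatticeAlgebra.d_zpow (h : IsLatticeAlgebra d Λ ε) (j : ℕ) (k : ℤ) (f : A) :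
    d j ((Λ ^ k) f) = (Λ ^ k) (d j f) := by
  have hinv : ∀ f, d j (Λ⁻¹ f) = Λ⁻¹ (d j f) := fun f => by
    apply Λ.injective
    have e : ∀ g, Λ (Λ⁻¹ g) = g := Λ.apply_symm_apply
    rw [← h.shift, e, e]
  induction k with
  | zero => simp
  | succ k ih => rw [zpow_add_one, ← (Commute.zpow_self Λ k).eq.symm, ← zpow_one_add, zpow_one_add,
      AlgEquiv.mul_apply, h.shift, ih, AlgEquiv.mul_apply]
  | pred k ih => rw [sub_eq_neg_add, zpow_add, zpow_neg_one, AlgEquiv.mul_apply, hinv, ih,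
      AlgEquiv.mul_apply]

theorem IsLatticeAlgebra.zpow_eps (h : IsLatticeAlgebra d Λ ε) (k : ℤ) : (Λ ^ k) (ε : A) = ε := by
  have hinv : Λ⁻¹ (ε : A) = ε := by
    apply Λ.injective
    rw [h.shift_eps]
    exact Λ.apply_symm_apply _
  induction k with
  | zero => simp
  | succ k ih => rw [zpow_add_one, AlgEquiv.mul_apply, h.shift_eps, ih]
  | pred k ih => rw [zpow_sub_one, AlgEquiv.mul_apply, hinv, ih]

theorem zpow_formalTodaValue (v w : A) (k : ℤ) (p : TodaPoly) :
    (Λ ^ k) (formalTodaValue Λ v w p) = formalTodaValue Λ v w (todaShift k p) := by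
  have := map_todaEval ((Λ ^ k : A ≃ₐ[ℂ] A) : A →+* A) (fun k => (Λ ^ k) v) (fun k => (Λ ^ k) w) p
  rw [formalTodaValue, todaEval_todaShift]
  refine this.trans ?_
  congr 2 <;> funext m <;> rw [add_comm m, zpow_add] <;> rfl

variable {v w : A} {τ : Aˣ}

theorem IsFormalTodaTau.eps_mul_d_q (hτ : IsFormalTodaTau d Λ ε v w τ) (i : ℕ) :
    (ε : A) * d i (Λ τ * (↑τ⁻¹ : A)) =
      Λ τ * (↑τ⁻¹ : A) * formalTodaValue Λ v w (todaShift 1 (todaC (i + 1))) := by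
  have h1 : (τ : A) * (↑τ⁻¹ : A) = 1 := τ.mul_inv
  have h2 : Λ (τ : A) * Λ (↑τ⁻¹ : A) = 1 := by rw [← map_mul, h1, map_one]
  have h3 : (Λ τ * (↑τ⁻¹ : A)) * (τ * Λ (↑τ⁻¹ : A)) = 1 := by
    linear_combination Λ (τ : A) * Λ (↑τ⁻¹ : A) * h1 + h2
  rw [← hτ.one_point]
  linear_combination -(ε : A) * d i (Λ τ * (↑τ⁻¹ : A)) * h3

/-- The shift `Λ r = τ / Λτ` is the inverse of `q`. Differentiating `q * Λ r = 1` turns the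
one-point relation into the shifted claim, and `Λ` is injective. -/
theorem IsFormalTodaTau.eps_mul_d_r (hA : IsLatticeAlgebra d Λ ε)
    (hτ : IsFormalTodaTau d Λ ε v w τ) (i : ℕ) :
    (ε : A) * d i (Λ.symm τ * (↑τ⁻¹ : A)) =
      -(Λ.symm τ * (↑τ⁻¹ : A) * formalTodaValue Λ v w (todaC (i + 1))) := by
  have h1 : (τ : A) * (↑τ⁻¹ : A) = 1 := τ.mul_inv
  have h2 : Λ (τ : A) * Λ (↑τ⁻¹ : A) = 1 := by rw [← map_mul, h1, map_one]
  have h3 : (Λ τ * (↑τ⁻¹ : A)) * (τ * Λ (↑τ⁻¹ : A)) = 1 := by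
    linear_combination Λ (τ : A) * Λ (↑τ⁻¹ : A) * h1 + h2
  have h4 := congrArg (d i) h3
  rw [Derivation.leibniz, Derivation.map_one_eq_zero, smul_eq_mul, smul_eq_mul] at h4
  have h5 := zpow_formalTodaValue (Λ := Λ) v w 1 (todaC (i + 1))
  rw [zpow_one] at h5
  apply Λ.injective
  rw [map_mul Λ, map_neg Λ, map_mul Λ (Λ.symm _ * _), hA.shift_eps, ← hA.shift, map_mul Λ (Λ.symm _),
    Λ.apply_symm_apply, h5]
  linear_combination (ε : A) * (τ * Λ (↑τ⁻¹ : A)) * h4 - (ε : A) * d i (τ * Λ (↑τ⁻¹ : A)) * h3 -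
    (τ * Λ (↑τ⁻¹ : A)) * hτ.one_point i

/-- Only the flow `j = 0` and the one-point relation `i = 0` are used, moved to the site `k` by `Λ ^
k`. -/
theorem IsFormalTodaTau.isTodaNLSPair (hA : IsLatticeAlgebra d Λ ε)
    (hs : IsFormalTodaSolution d Λ ε v w) (hτ : IsFormalTodaTau d Λ ε v w τ) :
    IsTodaNLSPair (d 0) (ε : A) (fun k => (Λ ^ k) v) (fun k => (Λ ^ k) w)
      (Λ τ * (↑τ⁻¹ : A)) (Λ.symm τ * (↑τ⁻¹ : A)) where
  d_eps := hA.d_eps 0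
  d_v k := by
    have h := congrArg (fun f => (ε : A) * (Λ ^ k) f) (congrArg ((ε : A) * ·) (hs.flow_v 0))
    simp only [Units.mul_inv_cancel_left, zpow_formalTodaValue, zero_add, todaA_one, map_sub,
      todaShift_w, map_mul, hA.zpow_eps, ← hA.d_zpow] at h
    have h' := (ε.isUnit.mul_right_inj).1 h
    rw [h']
    simp [formalTodaValue, todaEval_w, add_comm]
  d_w k := by
    have h := congrArg (fun f => (Λ ^ k) f) (congrArg ((ε : A) * ·) (hs.flow_w 0))
    simp only [mul_assoc, Units.mul_inv_cancel_left, zpow_formalTodaValue, zero_add, todaC_one,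
      map_sub, todaShift_v, map_mul, hA.zpow_eps, ← hA.d_zpow] at h
    rw [h]
    simp only [formalTodaValue, todaEval_v]
    ring_nf
  d_q := by
    rw [hτ.eps_mul_d_q, zero_add, todaC_one, todaShift_v, formalTodaValue, todaEval_v, mul_comm]
    rfl
  d_r := by
    rw [hτ.eps_mul_d_r hA, zero_add, todaC_one, formalTodaValue, todaEval_v, mul_comm]
  q_mul_r := by
    rw [zpow_zero, AlgEquiv.one_apply, ← hτ.toda]
    ring

end FormalSolutions

/-! ### Functions of the times -/

section FunctionSolutions

open Filter Topology ContDiff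

theorem todaValue_add {𝕜 : Type*} {ε : ℂ} {v w : ℂ → (ℕ → 𝕜) → ℂ} (x : ℂ)
    (t : ℕ → 𝕜) (k : ℤ) (p : TodaPoly) :
    todaValue ε v w (x + k * ε) t p = todaValue ε v w x t (todaShift k p) := by
  rw [todaValue, todaValue, todaEval_todaShift]
  congr 2 <;> funext m <;> push_cast <;> ring_nf

theorem todaValue_v {𝕜 : Type*} {ε : ℂ} {v w : ℂ → (ℕ → 𝕜) → ℂ} (x : ℂ)
    (t : ℕ → 𝕜) (k : ℤ) :
    todaValue ε v w x t (varV k) = v (x + k * ε) t := todaEval_v ..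

theorem todaValue_w {𝕜 : Type*} {ε : ℂ} {v w : ℂ → (ℕ → 𝕜) → ℂ} (x : ℂ)
    (t : ℕ → 𝕜) (k : ℤ) :
    todaValue ε v w x t (varW k) = w (x + k * ε) t := todaEval_w ..

/-- The extension of a function on `U` by zero. -/
def zeroExtend {α : Type*} {U : Set α} (f : U → ℂ) : α → ℂ := Function.extend Subtype.val f 0

theorem zeroExtend_of_mem {α : Type*} {U : Set α} (f : U → ℂ) {t : α} (ht : t ∈ U) :
    zeroExtend f t = f ⟨t, ht⟩ :=
  Subtype.val_injective.extend_apply f 0 ⟨t, ht⟩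

variable {𝕜 : Type*} [RCLike 𝕜] {U : Set (ℕ → 𝕜)}

/-- Varying `t_j` alone is a displacement of the first `j + 1` times along their last coordinate.
Openness and smoothness in finitely many times thereby restrict to single coordinate lines. -/
theorem moveTimes_single_last (j : ℕ) (t : ℕ → 𝕜) :
    (fun s : 𝕜 => moveTimes t (Pi.single (Fin.last j) (s - t j))) = Function.update t j := by
  funext s k
  rcases eq_or_ne k j with rfl | hk
  · simp [moveTimes, ← Fin.natCast_eq_last, Pi.single_apply, Fin.ext_iff]
  · simp [moveTimes, hk, Fin.ext_iff]

theorem IsTimeDomain.eventually_update_mem (hU : IsTimeDomain U) {t : ℕ → 𝕜} (ht : t ∈ U) (j : ℕ) :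
    ∀ᶠ s in 𝓝 (t j), Function.update t j s ∈ U := by
  rw [← moveTimes_single_last]
  have hc : Continuous fun s : 𝕜 => (Pi.single (Fin.last j) (s - t j) : Fin (j + 1) → 𝕜) :=
    (continuous_single _).comp (by fun_prop)
  have := hc.tendsto (t j)
  rw [sub_self, Pi.single_zero] at this
  exact this.eventually (hU t ht (j + 1))

theorem moveTimes_zero (t : ℕ → 𝕜) (n : ℕ) : moveTimes t (0 : Fin n → 𝕜) = t := by
  funext k
  simp [moveTimes]

theorem IsLatticeDomain.mem_add_int_mul {ε : ℂ} {D : Set (ℂ × (ℕ → 𝕜))} (hD : IsLatticeDomain ε D) (x : ℂ)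
    (t : ℕ → 𝕜) (k : ℤ) :
    (x + k * ε, t) ∈ D ↔ (x, t) ∈ D := by
  induction k with
  | zero => simp
  | succ k ih =>
    rw [← ih, ← hD.shift (x + ((k : ℤ) : ℂ) * ε)]
    push_cast
    ring_nf
  | pred k ih =>
    rw [← ih, ← hD.shift (x + ((-k - 1 : ℤ) : ℂ) * ε)]
    push_cast
    ring_nf

theorem IsLatticeDomain.mem_sub {ε : ℂ} {D : Set (ℂ × (ℕ → 𝕜))} (hD : IsLatticeDomain ε D) (x : ℂ)
    (t : ℕ → 𝕜) :
    (x - ε, t) ∈ D ↔ (x, t) ∈ D := by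
  rw [← hD.shift (x - ε), sub_add_cancel]

variable [NormedAlgebra 𝕜 ℂ]

theorem SmoothInTimes.contDiffAt_update {f : (ℕ → 𝕜) → ℂ} (hf : SmoothInTimes U f) {t : ℕ → 𝕜}
    (ht : t ∈ U) (j : ℕ) : ContDiffAt 𝕜 ∞ (fun s => f (Function.update t j s)) (t j) := by
  rw [← moveTimes_single_last]
  have hc : ContDiff 𝕜 ∞ fun s : 𝕜 => (Pi.single (Fin.last j) (s - t j) : Fin (j + 1) → 𝕜) := by
    rw [contDiff_pi]
    intro i
    rcases eq_or_ne i (Fin.last j) with rfl | h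
    · simp only [Pi.single_eq_same]; fun_prop
    · simp only [Pi.single_eq_of_ne h]; fun_prop
  refine ContDiffAt.comp (t j) (g := fun s : Fin (j + 1) → 𝕜 => f (moveTimes t s)) ?_ hc.contDiffAt
  rw [sub_self, Pi.single_zero]
  exact hf t ht (j + 1)

theorem SmoothInTimes.mul {f g : (ℕ → 𝕜) → ℂ} (hf : SmoothInTimes U f) (hg : SmoothInTimes U g) :
    SmoothInTimes U fun t => f t * g t :=
  fun t ht n => (hf t ht n).mul (hg t ht n)

theorem SmoothInTimes.div {f g : (ℕ → 𝕜) → ℂ} (hf : SmoothInTimes U f) (hg : SmoothInTimes U g)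
    (h0 : ∀ t ∈ U, g t ≠ 0) : SmoothInTimes U fun t => f t / g t := by
  intro t ht n
  simp only [div_eq_mul_inv]
  exact (hf t ht n).mul ((hg t ht n).inv (by rw [moveTimes_zero]; exact h0 t ht))

/-- Nearby points on each coordinate line stay in `U`, so time derivatives on `U` ignore values
outside it. This makes the extension by zero harmless. -/
theorem timeDeriv_congr (hU : IsTimeDomain U) {f g : (ℕ → 𝕜) → ℂ} (h : Set.EqOn f g U) (j : ℕ)
    {t : ℕ → 𝕜} (ht : t ∈ U) : timeDeriv j f t = timeDeriv j g t :=
  EventuallyEq.deriv_eq ((hU.eventually_update_mem ht j).mono fun _ hs => h hs)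

/-! ### The differential algebra of functions on a slice that are smooth in the first time. -/

/-- `f` is smooth on `U` as a function of `t₀`. -/
def SmoothInFirstTime (U : Set (ℕ → 𝕜)) (f : (ℕ → 𝕜) → ℂ) : Prop :=
  ∀ t ∈ U, ContDiffAt 𝕜 ∞ (fun s => f (Function.update t 0 s)) (t 0)

theorem SmoothInTimes.smoothInFirstTime {f : (ℕ → 𝕜) → ℂ} (hf : SmoothInTimes U f) :
    SmoothInFirstTime U f :=
  fun _ ht => hf.contDiffAt_update ht 0

theorem SmoothInFirstTime.congr (hU : IsTimeDomain U) {f g : (ℕ → 𝕜) → ℂ}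
    (hf : SmoothInFirstTime U f) (h : Set.EqOn g f U) : SmoothInFirstTime U g :=
  fun t ht => (hf t ht).congr_of_eventuallyEq
    ((hU.eventually_update_mem ht 0).mono fun _ hs => h hs)

/-- Closure under `∂/∂t₀` makes the functions smooth in `t₀` a differential algebra. Smoothness in
this one time suffices there, because the differential polynomials contain only `t₀`-derivatives;
the other times enter pointwise, through the tau-function relations. -/
theorem SmoothInFirstTime.timeDeriv {f : (ℕ → 𝕜) → ℂ} (hf : SmoothInFirstTime U f) :
    SmoothInFirstTime U (timeDeriv 0 f) := by
  intro t ht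
  have : (fun s => TodaNLS.timeDeriv 0 f (Function.update t 0 s)) =
      deriv fun s => f (Function.update t 0 s) := by
    funext s
    simp [TodaNLS.timeDeriv]
  rw [this]
  have h := (hf t ht).fderiv_right (m := ∞) (by rfl)
  exact h.clm_apply contDiffAt_const

theorem SmoothInFirstTime.differentiableAt {f : (ℕ → 𝕜) → ℂ} (hf : SmoothInFirstTime U f)
    {t : ℕ → 𝕜} (ht : t ∈ U) : DifferentiableAt 𝕜 (fun s => f (Function.update t 0 s)) (t 0) :=
  (hf t ht).differentiableAt (by simp)

/-- The algebra of functions on `U` that are smooth in `t₀`. -/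
def firstTimeAlgebra (hU : IsTimeDomain U) : Subalgebra ℂ (U → ℂ) where
  carrier := {f | SmoothInFirstTime U (zeroExtend f)}
  mul_mem' {f g} hf hg := SmoothInFirstTime.congr hU
    (f := fun t => zeroExtend f t * zeroExtend g t) (fun t ht => (hf t ht).mul (hg t ht))
    fun t ht => by simp [zeroExtend_of_mem _ ht]
  add_mem' {f g} hf hg := SmoothInFirstTime.congr hU
    (f := fun t => zeroExtend f t + zeroExtend g t) (fun t ht => (hf t ht).add (hg t ht))
    fun t ht => by simp [zeroExtend_of_mem _ ht]
  algebraMap_mem' c := SmoothInFirstTime.congr hU (f := fun _ => c) (fun _ _ => contDiffAt_const)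
    fun t ht => by simp [zeroExtend_of_mem _ ht]

variable (hU : IsTimeDomain U)

/-- The restriction to `U` of a function that is smooth in `t₀`. -/
def restrictTimes (f : (ℕ → 𝕜) → ℂ) (hf : SmoothInFirstTime U f) : firstTimeAlgebra hU :=
  ⟨fun t => f t, hf.congr hU fun _ ht => zeroExtend_of_mem _ ht⟩

/-- The derivation `∂/∂t₀`. -/
def firstTimeDerivation : Derivation ℂ (firstTimeAlgebra hU) (firstTimeAlgebra hU) :=
  Derivation.mk'
    { toFun := fun f => restrictTimes hU (timeDeriv 0 (zeroExtend f.1)) f.2.timeDeriv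
      map_add' := fun f g => by
        refine Subtype.ext (funext fun t => ?_)
        refine (timeDeriv_congr hU (g := fun t => zeroExtend f.1 t + zeroExtend g.1 t)
          (fun t ht => by simp [zeroExtend_of_mem _ ht]) 0 t.2).trans ?_
        exact deriv_add (f.2.differentiableAt t.2) (g.2.differentiableAt t.2)
      map_smul' := fun c f => by
        refine Subtype.ext (funext fun t => ?_)
        refine (timeDeriv_congr hU (g := fun t => c * zeroExtend f.1 t)
          (fun t ht => by simp [zeroExtend_of_mem _ ht]) 0 t.2).trans ?_
        exact deriv_const_mul c (f.2.differentiableAt t.2) } fun f g => by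
    refine Subtype.ext (funext fun t => ?_)
    refine (timeDeriv_congr hU (g := fun t => zeroExtend f.1 t * zeroExtend g.1 t)
      (fun t ht => by simp [zeroExtend_of_mem _ ht]) 0 t.2).trans ?_
    refine (deriv_mul (f.2.differentiableAt t.2) (g.2.differentiableAt t.2)).trans ?_
    simp only [Function.update_eq_self, zeroExtend_of_mem _ t.2]
    change timeDeriv 0 (zeroExtend f.1) t * _ + _ * timeDeriv 0 (zeroExtend g.1) t =
      f.1 t * timeDeriv 0 (zeroExtend g.1) t + g.1 t * timeDeriv 0 (zeroExtend f.1) t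
    ring

theorem firstTimeDerivation_restrictTimes {f : (ℕ → 𝕜) → ℂ} (hf : SmoothInFirstTime U f) :
    firstTimeDerivation hU (restrictTimes hU f hf) =
      restrictTimes hU (timeDeriv 0 f) hf.timeDeriv :=
  Subtype.ext (funext fun t => timeDeriv_congr hU (fun _ ht => zeroExtend_of_mem _ ht) 0 t.2)

theorem iterate_firstTimeDerivation_restrictTimes {f : (ℕ → 𝕜) → ℂ} (hf : SmoothInFirstTime U f)
    (i : ℕ) : ∃ h, (firstTimeDerivation hU)^[i] (restrictTimes hU f hf) =
      restrictTimes hU ((timeDeriv 0)^[i] f) h := by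
  induction i with
  | zero => exact ⟨hf, rfl⟩
  | succ i ih =>
    obtain ⟨h, e⟩ := ih
    rw [Function.iterate_succ_apply', Function.iterate_succ_apply', e,
      firstTimeDerivation_restrictTimes]
    exact ⟨_, rfl⟩

/-- Evaluation at a point of `U`. -/
def evalAt (t : U) : firstTimeAlgebra hU →ₐ[ℂ] ℂ :=
  (Pi.evalAlgHom ℂ (fun _ : U => ℂ) t).comp (firstTimeAlgebra hU).val

/-- The bridge from the algebra to numbers: iterates of the derivation on restricted functions are
restrictions of iterated time derivatives. -/
theorem evalAt_nlsEval {q r : (ℕ → 𝕜) → ℂ} (hq : SmoothInFirstTime U q)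
    (hr : SmoothInFirstTime U r) (ε : ℂ) (t : U) (p : NLSPoly) :
    evalAt hU t (nlsEval (algebraMap ℂ (firstTimeAlgebra hU) ε)
      (fun i => (firstTimeDerivation hU)^[i] (restrictTimes hU q hq))
      (fun i => (firstTimeDerivation hU)^[i] (restrictTimes hU r hr)) p) =
    nlsEval ε (fun i => (timeDeriv 0)^[i] q t) (fun i => (timeDeriv 0)^[i] r t) p := by
  rw [map_nlsEval, AlgHom.commutes]
  congr 2 <;> funext i
  · obtain ⟨h, e⟩ := iterate_firstTimeDerivation_restrictTimes hU hq i
    rw [e]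
    rfl
  · obtain ⟨h, e⟩ := iterate_firstTimeDerivation_restrictTimes hU hr i
    rw [e]
    rfl

variable {hU} {ε : ℂ} {D : Set (ℂ × (ℕ → 𝕜))} {v w τ : ℂ → (ℕ → 𝕜) → ℂ}

/-! ### From Toda tau-functions on a lattice domain to NLS solutions. -/

theorem IsTodaTauOn.eps_mul_timeDeriv_q (hD : IsLatticeDomain ε D) (hτ : IsTodaTauOn ε D v w τ)
    {x : ℂ} {t : ℕ → 𝕜} (ht : (x, t) ∈ D) (i : ℕ) :
    ε * timeDeriv i (fun t => τ (x + ε) t / τ x t) t =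
      τ (x + ε) t / τ x t * todaValue ε v w x t (todaShift 1 (todaC (i + 1))) := by
  have h1 := hτ.ne_zero x t ht
  have h2 := hτ.ne_zero (x + ε) t ((hD.shift x t).2 ht)
  rw [← hτ.one_point x t ht i]
  field_simp

/-- The one-point relation at `x - ε` gives the logarithmic derivative of `τ(x) / τ(x - ε) = 1 /
r(x)`; inverting the function changes its sign. -/
theorem IsTodaTauOn.eps_mul_timeDeriv_r (hD : IsLatticeDomain ε D) (hτ : IsTodaTauOn ε D v w τ)
    {x : ℂ} {t : ℕ → 𝕜} (ht : (x, t) ∈ D) (i : ℕ) :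
    ε * timeDeriv i (fun t => τ (x - ε) t / τ x t) t =
      -(τ (x - ε) t / τ x t * todaValue ε v w x t (todaC (i + 1))) := by
  have ht' := (hD.mem_sub x t).2 ht
  have h1 := hτ.ne_zero x t ht
  have h2 := hτ.ne_zero (x - ε) t ht'
  have h := hτ.one_point (x - ε) t ht' i
  have e := todaValue_add (ε := ε) (v := v) (w := w) (x - ε) t 1 (todaC (i + 1))
  rw [Int.cast_one, one_mul, sub_add_cancel] at e
  rw [sub_add_cancel, ← e] at h
  have hs : SmoothInTimes {t | (x, t) ∈ D} fun t => τ x t / τ (x - ε) t :=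
    (hτ.smooth x).div (fun t ht => hτ.smooth (x - ε) t ((hD.mem_sub x t).2 ht))
      fun t ht => hτ.ne_zero _ _ ((hD.mem_sub x t).2 ht)
  have hi : timeDeriv i (fun t => τ (x - ε) t / τ x t) t =
      -timeDeriv i (fun t => τ x t / τ (x - ε) t) t / (τ x t / τ (x - ε) t) ^ 2 := by
    have := deriv_fun_inv'' (((hs.contDiffAt_update ht i)).differentiableAt (by simp))
      (by rw [Function.update_eq_self]; exact div_ne_zero h1 h2)
    simpa only [timeDeriv, inv_div, Function.update_eq_self] using this
  rw [hi, ← h]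
  field_simp

theorem IsTodaTauOn.isTodaNLSPair (hε : ε ≠ 0) (hD : IsLatticeDomain ε D)
    (hs : IsTodaSolutionOn ε D v w) (hτ : IsTodaTauOn ε D v w τ) (x : ℂ)
    (hv : ∀ k : ℤ, SmoothInFirstTime {t | (x, t) ∈ D} (v (x + k * ε)))
    (hw : ∀ k : ℤ, SmoothInFirstTime {t | (x, t) ∈ D} (w (x + k * ε)))
    (hq : SmoothInFirstTime {t | (x, t) ∈ D} fun t => τ (x + ε) t / τ x t)
    (hr : SmoothInFirstTime {t | (x, t) ∈ D} fun t => τ (x - ε) t / τ x t) :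
    IsTodaNLSPair (firstTimeDerivation (hD.slice x)) (algebraMap ℂ _ ε)
      (fun k => restrictTimes (hD.slice x) _ (hv k)) (fun k => restrictTimes (hD.slice x) _ (hw k))
      (restrictTimes (hD.slice x) _ hq) (restrictTimes (hD.slice x) _ hr) where
  d_eps := Derivation.map_algebraMap _ _
  d_v k := by
    rw [firstTimeDerivation_restrictTimes]
    refine Subtype.ext (funext fun t => ?_)
    change ε * timeDeriv 0 (v (x + k * ε)) t = w (x + (k + 1 : ℤ) * ε) t - w (x + k * ε) t
    rw [hs.flow_v _ _ ((hD.mem_add_int_mul x t k).2 t.2), mul_inv_cancel_left₀ hε, todaValue_add,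
      zero_add, todaA_one, todaShift_w, map_sub, map_sub, todaShift_w, todaShift_w, todaValue_w,
      todaValue_w]
    ring_nf
  d_w k := by
    rw [firstTimeDerivation_restrictTimes]
    refine Subtype.ext (funext fun t => ?_)
    change ε * timeDeriv 0 (w (x + k * ε)) t =
      w (x + k * ε) t * (v (x + k * ε) t - v (x + (k - 1 : ℤ) * ε) t)
    rw [hs.flow_w _ _ ((hD.mem_add_int_mul x t k).2 t.2), mul_assoc, mul_inv_cancel_left₀ hε,
      todaValue_add, zero_add, todaC_one, todaShift_v, map_sub, map_sub, todaShift_v, todaShift_v,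
      todaValue_v, todaValue_v]
    ring_nf
  d_q := by
    rw [firstTimeDerivation_restrictTimes]
    refine Subtype.ext (funext fun t => ?_)
    change ε * timeDeriv 0 (fun t => τ (x + ε) t / τ x t) t =
      v (x + (0 : ℤ) * ε) t * (τ (x + ε) t / τ x t)
    rw [hτ.eps_mul_timeDeriv_q hD t.2, zero_add, todaC_one, todaShift_v, todaValue_v, mul_comm]
    rfl
  d_r := by
    rw [firstTimeDerivation_restrictTimes]
    refine Subtype.ext (funext fun t => ?_)
    change ε * timeDeriv 0 (fun t => τ (x - ε) t / τ x t) t =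
      -(v (x + (-1 : ℤ) * ε) t * (τ (x - ε) t / τ x t))
    rw [hτ.eps_mul_timeDeriv_r hD t.2, zero_add, todaC_one, todaValue_v, mul_comm]
  q_mul_r := by
    refine Subtype.ext (funext fun t => ?_)
    change τ (x + ε) t / τ x t * (τ (x - ε) t / τ x t) = w (x + (0 : ℤ) * ε) t
    rw [Int.cast_zero, zero_mul, add_zero, ← hτ.toda x t t.2]
    ring

/-- At fixed `x` the algebraic identities for `B`, `C` and `Ω` hold in the algebra of functions on
the slice. Evaluated at `t`, they express the NLS right-hand sides through Toda quantities, which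
the one-point and two-point relations of `τ` identify with time derivatives. -/
theorem IsTodaTauOn.nlsSolution_nlsTau (hε : ε ≠ 0) (hD : IsLatticeDomain ε D)
    (hs : IsTodaSolutionOn ε D v w) (hτ : IsTodaTauOn ε D v w τ) (x : ℂ) :
    IsNLSSolutionOn ε {t | (x, t) ∈ D}
        (fun t => τ (x + ε) t / τ x t) (fun t => τ (x - ε) t / τ x t) ∧
      IsNLSTauOn ε {t | (x, t) ∈ D}
        (fun t => τ (x + ε) t / τ x t) (fun t => τ (x - ε) t / τ x t) (τ x) := by
  have hv : ∀ k : ℤ, SmoothInFirstTime {t | (x, t) ∈ D} (v (x + k * ε)) := fun k =>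
    SmoothInTimes.smoothInFirstTime fun t ht =>
      hs.smooth_v _ t ((hD.mem_add_int_mul x t k).2 ht)
  have hw : ∀ k : ℤ, SmoothInFirstTime {t | (x, t) ∈ D} (w (x + k * ε)) := fun k =>
    SmoothInTimes.smoothInFirstTime fun t ht =>
      hs.smooth_w _ t ((hD.mem_add_int_mul x t k).2 ht)
  have hq : SmoothInTimes {t | (x, t) ∈ D} fun t => τ (x + ε) t / τ x t :=
    SmoothInTimes.div (fun t ht => hτ.smooth _ t ((hD.shift x t).2 ht)) (hτ.smooth x) (hτ.ne_zero x)
  have hr : SmoothInTimes {t | (x, t) ∈ D} fun t => τ (x - ε) t / τ x t :=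
    SmoothInTimes.div (fun t ht => hτ.smooth _ t ((hD.mem_sub x t).2 ht)) (hτ.smooth x)
      (hτ.ne_zero x)
  have hp := hτ.isTodaNLSPair hε hD hs x hv hw hq.smoothInFirstTime hr.smoothInFirstTime
  have eval_toda : ∀ (t : {t | (x, t) ∈ D}) (p : TodaPoly), evalAt (hD.slice x) t
      (todaEval (fun k => restrictTimes (hD.slice x) _ (hv k))
        (fun k => restrictTimes (hD.slice x) _ (hw k)) p) = todaValue ε v w x t p :=
    fun t p => map_todaEval (evalAt (hD.slice x) t).toRingHom
      (fun k => restrictTimes (hD.slice x) _ (hv k)) (fun k => restrictTimes (hD.slice x) _ (hw k)) p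
  refine ⟨⟨hq, hr, fun t ht j => ?_, fun t ht j => ?_⟩,
    ⟨hτ.smooth x, hτ.ne_zero x, fun t ht i j => ?_⟩⟩
  · have h := congrArg (evalAt (hD.slice x) ⟨t, ht⟩) (hp.nlsEval_nlsB j)
    rw [map_mul, map_mul, map_pow, map_ofNat, evalAt_nlsEval, eval_toda] at h
    exact (hτ.eps_mul_timeDeriv_q hD ht j).trans h.symm
  · have h := congrArg (evalAt (hD.slice x) ⟨t, ht⟩) (hp.nlsEval_nlsC j)
    rw [map_mul, map_neg, map_mul, map_pow, map_ofNat, evalAt_nlsEval, eval_toda] at h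
    exact (hτ.eps_mul_timeDeriv_r hD ht j).trans h.symm
  · have h := congrArg (evalAt (hD.slice x) ⟨t, ht⟩) (hp.nlsEval_nlsOmega i j)
    rw [evalAt_nlsEval, eval_toda] at h
    exact (hτ.two_point x t ht i j).trans h.symm

end FunctionSolutions

end TodaNLS

end

theorem theorem2 :
    (∀ (𝕜 : Type*) [RCLike 𝕜] [NormedAlgebra 𝕜 ℂ] (ε : ℂ) (_ : ε ≠ 0)
      (D : Set (ℂ × (ℕ → 𝕜))) (_ : TodaNLS.IsLatticeDomain ε D)
      (v w τ : ℂ → (ℕ → 𝕜) → ℂ),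
      TodaNLS.IsTodaSolutionOn ε D v w → TodaNLS.IsTodaTauOn ε D v w τ →
      ∀ x : ℂ,
        TodaNLS.IsNLSSolutionOn ε {t | (x, t) ∈ D}
          (fun t => τ (x + ε) t / τ x t) (fun t => τ (x - ε) t / τ x t) ∧
        TodaNLS.IsNLSTauOn ε {t | (x, t) ∈ D}
          (fun t => τ (x + ε) t / τ x t) (fun t => τ (x - ε) t / τ x t) (τ x)) ∧
    (∀ (A : Type*) [CommRing A] [Algebra ℂ A]
      (d : ℕ → Derivation ℂ A A) (Λ : A ≃ₐ[ℂ] A) (ε : Aˣ)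
      (_ : TodaNLS.IsLatticeAlgebra d Λ ε) (v w : A) (τ : Aˣ),
      TodaNLS.IsFormalTodaSolution d Λ ε v w → TodaNLS.IsFormalTodaTau d Λ ε v w τ →
        TodaNLS.IsFormalNLSSolution d ε (Λ τ * (↑τ⁻¹ : A)) (Λ.symm τ * (↑τ⁻¹ : A)) ∧
        TodaNLS.IsFormalNLSTau d ε (Λ τ * (↑τ⁻¹ : A)) (Λ.symm τ * (↑τ⁻¹ : A)) τ) := by
  refine ⟨fun 𝕜 _ _ ε hε D hD v w τ hs hτ x => hτ.nlsSolution_nlsTau hε hD hs x,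
    fun A _ _ d Λ ε hA v w τ hs hτ => ?_⟩
  have hp := hτ.isTodaNLSPair hA hs
  exact ⟨⟨fun j => (hτ.eps_mul_d_q j).trans (hp.nlsEval_nlsB j).symm,
    fun j => (hτ.eps_mul_d_r hA j).trans (hp.nlsEval_nlsC j).symm⟩,
    fun i j => (hτ.two_point i j).trans (hp.nlsEval_nlsOmega i j).symm⟩
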